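/- Let $k$ be a field. An $\mathbb{A}^2$-form over $k$ with respect to a field extension $L|k$ is a commutative $k$-algebra $A$ such that $A\otimes_k L$ is isomorphic, as an $L$-algebra, to the polynomial ring in two indeterminates over $L$. An exponential map (that is, a $\mathbb{G}_a$-action) on a $k$-algebra $A$ is a $k$-algebra homomorphism $\phi=\phi_U\colon A\to A[U]$ such that composing $\phi_U$ with the evaluation at $U=0$ gives the identity of $A$, and $\phi_V\circ\phi_U=\phi_{U+V}$, where on the left-hand side $\phi_V$ is extended to $A[U]\to A[U,V]$ by $\phi_V(U)=U$. It is nontrivial if $\phi(a)\neq a$ for some $a\in A$, and $A$ is called non-rigid if it admits a nontrivial exponential map. Theorem. Let $A$ be an $\mathbb{A}^2$-form over a field $k$ with respect to some field extension $L|k$. Suppose that (i) $A$ is a UFD, (ii) $A$ has a $k$-rational point, i.e. there is a $k$-algebra homomorphism $A\to k$, and (iii) $A$ is non-rigid. Then $A$ is isomorphic, as a $k$-algebra, to the polynomial ring $k^{[2]}$ in two indeterminates over $k$. Moreover, none of the three hypotheses can be dropped: for each of (i), (ii), (iii) there are a field extension $L|k$ and an $\mathbb{A}^2$-form $A$ over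 $k$ with respect to $L|k$ that satisfies the other two hypotheses and is not isomorphic to $k^{[2]}$ as a $k$-algebra. -/

import Mathlib

open scoped Polynomial TensorProduct

/-- `A = k^{[n]}`: the `k`-algebra `A` is isomorphic to the polynomial ring over `k` in `n`
indeterminates. -/
def IsPolynomialRing (n : ℕ) (k A : Type*) [Field k] [CommRing A] [Algebra k A] : Prop :=
  Nonempty (A ≃ₐ[k] MvPolynomial (Fin n) k)

/-- `A` is an `𝔸ⁿ`-form over `k` with respect to the field extension `L | k`: after extension of
scalars to `L`, it becomes the polynomial ring over `L` in `n` indeterminates. -/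
def IsAffineForm (n : ℕ) (k L A : Type*) [Field k] [Field L] [Algebra k L]
    [CommRing A] [Algebra k A] : Prop :=
  IsPolynomialRing n L (L ⊗[k] A)

/-- `A` is a unique factorization domain. -/
def IsUFD (A : Type*) [CommRing A] : Prop :=
  IsDomain A ∧ UniqueFactorizationMonoid A

/-- `A` has a `k`-rational point, that is, a retraction `A → k` of `k`-algebras. -/
def HasRationalPoint (k A : Type*) [Field k] [CommRing A] [Algebra k A] : Prop :=
  Nonempty (A →ₐ[k] k)

/-- Exponential maps (equivalently, `𝔾ₐ`-actions) on the `k`-algebra `A`: homomorphisms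
`φ = φ_U : A → A[U]` of `k`-algebras with `ε₀ ∘ φ_U = id` and `φ_V ∘ φ_U = φ_{U + V}`.
In `A[X][X]` the outer variable is `U` and the inner one is `V`, so `φ_V`, extended by `U ↦ U`,
is the application of `φ` to every coefficient. -/
structure ExponentialMap (k A : Type*) [Field k] [CommRing A] [Algebra k A] where
  /-- the underlying homomorphism `A → A[U]` -/
  toAlgHom : A →ₐ[k] A[X]
  eval_zero : ∀ a : A, (toAlgHom a).eval 0 = a
  comp_eq : ∀ a : A, (toAlgHom a).map (toAlgHom : A →+* A[X]) =
    (toAlgHom a).eval₂ ((Polynomial.C : A[X] →+* A[X][X]).comp (Polynomial.C : A →+* A[X]))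
      (Polynomial.X + Polynomial.C Polynomial.X)

/-- The ring of invariants `A^φ` of an exponential map, as a set. -/
def ExponentialMap.invariants {k A : Type*} [Field k] [CommRing A] [Algebra k A]
    (φ : ExponentialMap k A) : Set A :=
  {a | φ.toAlgHom a = Polynomial.C a}

/-- `A` is non-rigid: it admits a nontrivial exponential map. -/
def IsNonRigid (k A : Type*) [Field k] [CommRing A] [Algebra k A] : Prop :=
  ∃ φ : ExponentialMap k A, φ.invariants ≠ Set.univ

/-! The invariants of a nontrivial exponential map form a factorially closed subring `R` of `A`. A
non-invariant `x` whose image has least degree in `U` has an invariant leading coefficient `c`, and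
division by powers of `x` gives `A[c⁻¹] = R[c⁻¹][x]`. So `R` has transcendence degree at most one
over `k`. It is not `k`, since otherwise `A = k[x]`, which is too small for a form of the plane.

Total degree on `L ⊗ A ≅ L^[2]` restricts to a degree function on `A`. Let `f` in `R` have least
positive degree and vanish at the rational point. It is irreducible, hence prime because `A` is
factorial. Any other invariant vanishing at the point is algebraically dependent on `f`, and the
dependence forces it to be a multiple of `f`. Induction on the degree gives `R = k[f]`
(`exists_generator_of_degree`).

Now `A` is generically a polynomial ring in one variable over the principal ideal domain `k[f]`. The
Russell-Sathaye algorithm (`exists_transcendental_generator`) removes the prime factors `p` of `c`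
one by one. It needs `pA ∩ k[f] = p k[f]`, and that `k[f]/p` is algebraically closed in `A/pA`
without being all of it. The first condition is factorial closedness. The other two are checked over
an algebraically closed `L`: the extended action has invariants `L[f]`, again factorially closed, so
every `f - μ` is prime in `L ⊗ A` (`prime_one_tmul_sub`).

The counterexamples live over the constants `k` of `d = d/dt` on `K = 𝔽₂(t)`, where `d² = 0`. If a
derivation `D` of a polynomial ring over `K` extends `d` and `D² = 0`, then `b = (b + t D b) + t D
b` shows that `ker D` is a form of that ring. By Samuel's descent `ker D` is factorial once `D h =
h²` forces `h` in `K`. On a line take `D w = w² + β`, then adjoin a free variable to have an action: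
`β = 0` destroys factoriality, and `β = t⁻²` keeps it but leaves no rational point. In the plane `D
w = y²`, `D y = t² w²` gives a factorial form with a point, and a comparison of degrees shows that
it is not a polynomial ring. -/

namespace ExponentialMap

open Polynomial

/-! ### Exponential maps and factorial closedness of the invariants -/

section Basic

variable {k A : Type*} [Field k] [CommRing A] [Algebra k A] (φ : ExponentialMap k A)

lemma mem_invariants {a : A} : a ∈ φ.invariants ↔ φ.toAlgHom a = C a := Iff.rfl

lemma coeff_zero (a : A) : (φ.toAlgHom a).coeff 0 = a := by
  rw [coeff_zero_eq_eval_zero, φ.eval_zero]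

lemma injective : Function.Injective φ.toAlgHom := fun a b h ↦ by
  rw [← φ.eval_zero a, h, φ.eval_zero]

lemma mem_invariants_iff_natDegree {a : A} :
    a ∈ φ.invariants ↔ (φ.toAlgHom a).natDegree = 0 := by
  rw [mem_invariants]
  refine ⟨fun h ↦ by rw [h, natDegree_C], fun h ↦ ?_⟩
  rw [eq_C_of_natDegree_eq_zero h, φ.coeff_zero]

lemma coeff_coeff_eval₂_add (p : A[X]) (i j : ℕ) :
    ((p.eval₂ ((C : A[X] →+* A[X][X]).comp (C : A →+* A[X])) (X + C X)).coeff i).coeff j =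
      (i + j).choose i * p.coeff (i + j) := by
  induction p using Polynomial.induction_on' with
  | add p q hp hq => simp only [eval₂_add, coeff_add, hp, hq, mul_add]
  | monomial n a =>
    rw [eval₂_monomial, RingHom.comp_apply, coeff_C_mul, coeff_X_add_C_pow, coeff_C_mul,
      coeff_monomial, coeff_mul_natCast, coeff_X_pow]
    rcases lt_or_ge n i with h | h
    · simp [Nat.choose_eq_zero_of_lt h, show ¬ n = i + j by omega]
    · by_cases hj : j = n - i
      · rw [if_pos hj, if_pos (by omega), show i + j = n by omega]
        ring
      · rw [if_neg hj, if_neg (by omega)]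
        simp

/-- Comparison of the coefficients of `U^i V^j` in the group law: the coefficient maps form an
iterative higher derivation. -/
lemma coeff_toAlgHom_coeff (a : A) (i j : ℕ) :
    (φ.toAlgHom ((φ.toAlgHom a).coeff i)).coeff j =
      (i + j).choose i * (φ.toAlgHom a).coeff (i + j) := by
  rw [← coeff_coeff_eval₂_add, ← φ.comp_eq, coeff_map]
  rfl

lemma natDegree_toAlgHom_coeff_le (a : A) (i : ℕ) :
    (φ.toAlgHom ((φ.toAlgHom a).coeff i)).natDegree ≤ (φ.toAlgHom a).natDegree - i := by
  refine natDegree_le_iff_coeff_eq_zero.2 fun j hj ↦ ?_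
  rw [coeff_toAlgHom_coeff, coeff_eq_zero_of_natDegree_lt (by omega), mul_zero]

/-- The ring of invariants of an exponential map, as a subalgebra. -/
def invariantSubalgebra : Subalgebra k A where
  carrier := φ.invariants
  mul_mem' {a b} ha hb := by
    rw [mem_invariants] at *
    rw [map_mul, ha, hb, C_mul]
  add_mem' {a b} ha hb := by
    rw [mem_invariants] at *
    rw [map_add, ha, hb, C_add]
  algebraMap_mem' r := by
    rw [mem_invariants, AlgHom.commutes]
    rfl

lemma mem_invariantSubalgebra {a : A} : a ∈ φ.invariantSubalgebra ↔ φ.toAlgHom a = C a := Iff.rfl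

lemma mem_invariantSubalgebra_iff_natDegree {a : A} :
    a ∈ φ.invariantSubalgebra ↔ (φ.toAlgHom a).natDegree = 0 :=
  φ.mem_invariants_iff_natDegree

lemma natDegree_mul [IsDomain A] {a b : A} (ha : a ≠ 0) (hb : b ≠ 0) :
    (φ.toAlgHom (a * b)).natDegree = (φ.toAlgHom a).natDegree + (φ.toAlgHom b).natDegree := by
  rw [map_mul, Polynomial.natDegree_mul] <;> rwa [Ne, map_eq_zero_iff _ φ.injective]

/-- The ring of invariants is factorially closed. -/
lemma mem_invariantSubalgebra_of_mul_mem [IsDomain A] {a b : A} (hab : a * b ≠ 0)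
    (h : a * b ∈ φ.invariantSubalgebra) : a ∈ φ.invariantSubalgebra := by
  rw [mem_invariantSubalgebra_iff_natDegree] at *
  rw [φ.natDegree_mul (left_ne_zero_of_mul hab) (right_ne_zero_of_mul hab)] at h
  omega

end Basic

/-! ### Local slices -/

section Slice

variable {k A : Type*} [Field k] [CommRing A] [Algebra k A] (φ : ExponentialMap k A)

/-- A local slice: a non-invariant element of minimal degree. -/
structure IsLocalSlice (x : A) : Prop where
  notMem : x ∉ φ.invariantSubalgebra
  mem_of_lt : ∀ a, (φ.toAlgHom a).natDegree < (φ.toAlgHom x).natDegree →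
    a ∈ φ.invariantSubalgebra

lemma exists_isLocalSlice (h : φ.invariants ≠ Set.univ) : ∃ x, φ.IsLocalSlice x := by
  classical
  have h' : ∃ n a, a ∉ φ.invariantSubalgebra ∧ (φ.toAlgHom a).natDegree = n := by
    obtain ⟨a, ha⟩ := (Set.ne_univ_iff_exists_notMem _).1 h
    exact ⟨_, a, ha, rfl⟩
  obtain ⟨x, hx, hn⟩ := Nat.find_spec h'
  refine ⟨x, hx, fun a ha ↦ ?_⟩
  by_contra hna
  rw [hn] at ha
  exact Nat.find_min h' ha ⟨a, hna, rfl⟩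

variable {φ} {x : A}

lemma IsLocalSlice.natDegree_pos (hx : φ.IsLocalSlice x) : 0 < (φ.toAlgHom x).natDegree := by
  have := hx.notMem
  rw [mem_invariantSubalgebra_iff_natDegree] at this
  omega

lemma leadingCoeff_mem (a : A) : (φ.toAlgHom a).leadingCoeff ∈ φ.invariantSubalgebra := by
  rw [mem_invariantSubalgebra_iff_natDegree]
  have := φ.natDegree_toAlgHom_coeff_le a (φ.toAlgHom a).natDegree
  rw [leadingCoeff]
  omega

lemma IsLocalSlice.leadingCoeff_ne_zero (hx : φ.IsLocalSlice x) :
    (φ.toAlgHom x).leadingCoeff ≠ 0 := by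
  intro h
  have := hx.natDegree_pos
  rw [Polynomial.leadingCoeff_eq_zero] at h
  rw [h, natDegree_zero] at this
  exact this.false

/-- By minimality the intermediate coefficients of `φ(x)` are invariant, so iterating to the top
coefficient gives zero, whereas the group law gives a binomial multiple of it. Thus the degree of a
slice is 1 or a power of the characteristic. -/
lemma IsLocalSlice.choose_eq_zero [IsDomain A] (hx : φ.IsLocalSlice x) {i : ℕ} (hi : 0 < i)
    (hin : i < (φ.toAlgHom x).natDegree) :
    (((φ.toAlgHom x).natDegree.choose i : ℕ) : A) = 0 := by
  set n := (φ.toAlgHom x).natDegree with hn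
  have h1 : (φ.toAlgHom x).coeff i ∈ φ.invariantSubalgebra :=
    hx.mem_of_lt _ ((φ.natDegree_toAlgHom_coeff_le x i).trans_lt (by omega))
  have h2 := φ.coeff_toAlgHom_coeff x i (n - i)
  rw [φ.mem_invariantSubalgebra.1 h1, coeff_C, if_neg (by omega), show i + (n - i) = n by omega]
    at h2
  exact (mul_eq_zero.1 h2.symm).resolve_right hx.leadingCoeff_ne_zero

/-- A weak form of Lucas' theorem: `(1 + X)^n = 1 + X^n`, so `(1 + X)^(nq + r)` agrees with `(1 +
X)^r` modulo `X^n`. -/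
lemma choose_mul_add_eq_one {n : ℕ} (h : ∀ i, 0 < i → i < n → ((n.choose i : ℕ) : A) = 0)
    (q : ℕ) {r : ℕ} (hr : r < n) : (((n * q + r).choose r : ℕ) : A) = 1 := by
  have h1 : ((1 + X : A[X])) ^ n = 1 + X ^ n := by
    ext i
    rw [coeff_one_add_X_pow, coeff_add, coeff_one, coeff_X_pow]
    rcases Nat.eq_zero_or_pos i with rfl | hi
    · simp [show ¬ 0 = n by omega]
    · rcases lt_trichotomy i n with hin | rfl | hin
      · rw [h i hi hin, if_neg (by omega), if_neg (by omega), add_zero]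
      · simp [show ¬ i = 0 by omega]
      · rw [Nat.choose_eq_zero_of_lt hin, if_neg (by omega), if_neg (by omega)]
        simp
  obtain ⟨g, hg⟩ : (X ^ n : A[X]) ∣ (1 + X) ^ (n * q) - 1 := by
    rw [pow_mul, h1]
    have := sub_dvd_pow_sub_pow (1 + X ^ n : A[X]) 1 q
    simpa using this
  have h2 : (1 + X : A[X]) ^ (n * q + r) = (1 + X) ^ r + X ^ n * (g * (1 + X) ^ r) := by
    rw [pow_add, ← sub_add_cancel ((1 + X : A[X]) ^ (n * q)) 1, hg]
    ring
  have h3 := congr_arg (coeff · r) h2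
  simp only [coeff_one_add_X_pow, coeff_add, coeff_X_pow_mul', if_neg (not_le.2 hr)] at h3
  simpa using h3

/-- Write the degree as `nq + r` with `0 < r < n`. The coefficient at `nq` has degree at most `r`,
so it is invariant by minimality of `n`; but its own coefficient at `r` is the leading coefficient
of `φ(a)`, the binomial factor being 1. -/
lemma IsLocalSlice.dvd_natDegree [IsDomain A] (hx : φ.IsLocalSlice x) (a : A) :
    (φ.toAlgHom x).natDegree ∣ (φ.toAlgHom a).natDegree := by
  set n := (φ.toAlgHom x).natDegree with hn
  set d := (φ.toAlgHom a).natDegree with hd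
  have hn0 := hx.natDegree_pos
  rw [← hn] at hn0
  by_contra hnd
  have hr0 : d % n ≠ 0 := fun h ↦ hnd (Nat.dvd_of_mod_eq_zero h)
  have hrn : d % n < n := Nat.mod_lt _ hn0
  have hdq : n * (d / n) + d % n = d := Nat.div_add_mod d n
  have h1 : (φ.toAlgHom a).coeff (n * (d / n)) ∈ φ.invariantSubalgebra :=
    hx.mem_of_lt _ ((φ.natDegree_toAlgHom_coeff_le a _).trans_lt (by omega))
  have h2 := φ.coeff_toAlgHom_coeff a (n * (d / n)) (d % n)
  rw [φ.mem_invariantSubalgebra.1 h1, coeff_C, if_neg hr0, Nat.choose_symm_add,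
    choose_mul_add_eq_one (fun i hi hin ↦ hx.choose_eq_zero hi hin) _ hrn, one_mul, hdq] at h2
  have h3 : φ.toAlgHom a = 0 := leadingCoeff_eq_zero.1 h2.symm
  rw [h3, natDegree_zero] at hd
  rw [hd] at hnd
  exact hnd (dvd_zero _)

variable {S : Type*} [CommRing S] [Algebra S A]

/-- Inverting the leading coefficient of a local slice turns `A` into a polynomial ring over the
invariants. -/
lemma IsLocalSlice.exists_pow_mul_eq_aeval [IsDomain A] (hx : φ.IsLocalSlice x)
    (hS : ∀ a, a ∈ φ.invariantSubalgebra ↔ a ∈ Set.range (algebraMap S A)) (a : A) :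
    ∃ (m : ℕ) (F : S[X]), (φ.toAlgHom x).leadingCoeff ^ m * a = aeval x F := by
  set c := (φ.toAlgHom x).leadingCoeff with hc
  have hcR : c ∈ φ.invariantSubalgebra := leadingCoeff_mem x
  obtain ⟨c', hc'⟩ := (hS c).1 hcR
  have hc0 : c ≠ 0 := hx.leadingCoeff_ne_zero
  induction hd : (φ.toAlgHom a).natDegree using Nat.strong_induction_on generalizing a with
  | _ d ih =>
    rcases Nat.eq_zero_or_pos d with rfl | hd0
    · obtain ⟨b, rfl⟩ := (hS a).1 (φ.mem_invariantSubalgebra_iff_natDegree.2 hd)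
      exact ⟨0, C b, by simp⟩
    · obtain ⟨q, hq⟩ := hx.dvd_natDegree a
      set l := (φ.toAlgHom a).leadingCoeff with hl
      have hlR : l ∈ φ.invariantSubalgebra := leadingCoeff_mem a
      have hl0 : l ≠ 0 := by
        intro h
        rw [hl, Polynomial.leadingCoeff_eq_zero] at h
        rw [h, natDegree_zero] at hd
        omega
      obtain ⟨l', hl'⟩ := (hS l).1 hlR
      -- Division by `x`: both terms have degree `d = nq` in `U` and leading coefficient `c^q l`.
      have hlt : (φ.toAlgHom (c ^ q * a - l * x ^ q)).natDegree < d := by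
        rw [map_sub, map_mul, map_mul, map_pow, map_pow, φ.mem_invariantSubalgebra.1 hcR,
          φ.mem_invariantSubalgebra.1 hlR, ← C_pow]
        have e1 : (C (c ^ q) * φ.toAlgHom a).natDegree = d := by
          rw [natDegree_C_mul (pow_ne_zero _ hc0), hd]
        have e2 : (C l * φ.toAlgHom x ^ q).natDegree = d := by
          rw [natDegree_C_mul hl0, natDegree_pow, mul_comm, ← hq, hd]
        have e3 : (C (c ^ q) * φ.toAlgHom a).leadingCoeff =
            (C l * φ.toAlgHom x ^ q).leadingCoeff := by
          rw [leadingCoeff_mul, leadingCoeff_mul, leadingCoeff_C, leadingCoeff_C,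
            leadingCoeff_pow, mul_comm]
        refine lt_of_le_of_ne ((natDegree_sub_le _ _).trans (by rw [e1, e2, max_self])) fun h ↦ ?_
        have h5 : (C (c ^ q) * φ.toAlgHom a - C l * φ.toAlgHom x ^ q).coeff d = 0 := by
          rw [coeff_sub, sub_eq_zero]
          conv_lhs => rw [← e1]
          conv_rhs => rw [← e2]
          exact e3
        rw [← h] at h5
        have h6 := Polynomial.leadingCoeff_eq_zero.1 h5
        rw [h6, natDegree_zero] at h
        omega
      obtain ⟨m, F, hF⟩ := ih _ hlt _ rfl
      refine ⟨m + q, F + C (c' ^ m * l') * X ^ q, ?_⟩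
      rw [map_add, ← hF, map_mul, map_pow, aeval_X, aeval_C, map_mul, map_pow, hc', hl']
      ring

/-- Applying `φ` to a relation `P(x) = 0` fixes the coefficients and gives `P(φ(x)) = 0`, where
`φ(x)` has positive degree in `U`. -/
lemma IsLocalSlice.transcendental [IsDomain A] (hx : φ.IsLocalSlice x)
    (hS : ∀ a, a ∈ φ.invariantSubalgebra ↔ a ∈ Set.range (algebraMap S A))
    (hinj : Function.Injective (algebraMap S A)) : Transcendental S x := by
  rw [transcendental_iff]
  intro P hP
  have h1 : (P.map (algebraMap S A)).comp (φ.toAlgHom x) = 0 := by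
    have h2 := congr_arg φ.toAlgHom hP
    rw [map_zero, aeval_def, ← AlgHom.coe_toRingHom, hom_eval₂] at h2
    rw [comp, eval₂_map, ← h2]
    congr 1
    ext1 s
    exact ((φ.mem_invariantSubalgebra).1 ((hS _).2 ⟨s, rfl⟩)).symm
  have h2 := natDegree_comp (p := P.map (algebraMap S A)) (q := φ.toAlgHom x)
  rw [h1, natDegree_zero, eq_comm, mul_eq_zero, natDegree_map_eq_of_injective hinj] at h2
  have h3 := eq_C_of_natDegree_eq_zero (h2.resolve_right hx.natDegree_pos.ne')
  rw [h3, aeval_C, map_eq_zero_iff _ hinj] at hP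
  rw [h3, hP, C_0]

end Slice

end ExponentialMap

/-! ### The Russell-Sathaye criterion -/

section RussellSathaye

open Polynomial

variable {S A : Type*} [CommRing S] [CommRing A] [Algebra S A]

lemma pow_dvd_of_algebraMap_pow_dvd [IsDomain A] {p : S} (hp : p ≠ 0)
    (hinj : Function.Injective (algebraMap S A))
    (h1 : ∀ s, algebraMap S A p ∣ algebraMap S A s → p ∣ s) (n : ℕ) (s : S)
    (h : algebraMap S A p ^ n ∣ algebraMap S A s) : p ^ n ∣ s := by
  induction n generalizing s with
  | zero => simp
  | succ n ih =>
    obtain ⟨t, rfl⟩ := h1 s ((dvd_pow_self _ n.succ_ne_zero).trans h)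
    rw [pow_succ', map_mul] at h
    rw [pow_succ']
    refine mul_dvd_mul_left p (ih t ((mul_dvd_mul_iff_left ?_).1 h))
    rwa [Ne, map_eq_zero_iff _ hinj]

/-- When `y` is transcendental modulo `p`, a polynomial expression in `y` divisible by `p` has all
its coefficients divisible by `p`, so the denominators cancel one factor at a time. -/
lemma exists_eq_aeval_of_pow_mul_eq_aeval [IsDomain A] {p : S} (hp : p ≠ 0)
    (hinj : Function.Injective (algebraMap S A)) {y : A}
    (hy : ∀ F : S[X], algebraMap S A p ∣ aeval y F → C p ∣ F) (n : ℕ) (b : A) (F : S[X])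
    (h : algebraMap S A p ^ n * b = aeval y F) : ∃ G : S[X], b = aeval y G := by
  induction n generalizing F with
  | zero => exact ⟨F, by simpa using h⟩
  | succ n ih =>
    obtain ⟨G, rfl⟩ := hy F ⟨algebraMap S A p ^ n * b, by rw [← h, pow_succ', mul_assoc]⟩
    refine ih G (mul_left_cancel₀ (a := algebraMap S A p) ?_ ?_)
    · rwa [Ne, map_eq_zero_iff _ hinj]
    · rw [← mul_assoc, ← pow_succ', h, map_mul, aeval_C]

lemma Transcendental.of_add_mul [IsDomain S] {r q : S} {x y : A} (hx : Transcendental S x)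
    (h : x = algebraMap S A r + algebraMap S A q * y) : Transcendental S y := fun hy ↦
  hx (h ▸ (isAlgebraic_algebraMap r).add ((isAlgebraic_algebraMap q).mul hy))

/-- One step of the Russell-Sathaye algorithm: a prime `p` of the base over which `A` has no
algebraic elements besides the obvious ones can be removed from the denominators. -/
lemma exists_generator_of_prime [IsDomain S] [IsDomain A] {p : S} (hp : p ≠ 0)
    (hinj : Function.Injective (algebraMap S A))
    (h1 : ∀ s, algebraMap S A p ∣ algebraMap S A s → p ∣ s)
    (h2 : ∀ (x : A) (F : S[X]), algebraMap S A p ∣ aeval x F → ¬ C p ∣ F →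
      ∃ r, algebraMap S A p ∣ x - algebraMap S A r)
    (h3 : ∃ a : A, ∀ r, ¬ algebraMap S A p ∣ a - algebraMap S A r)
    {e : ℕ} {c : S} (hc : IsCoprime c p) {x : A} (hx : Transcendental S x)
    (hgen : ∀ a : A, ∃ (m : ℕ) (F : S[X]), algebraMap S A (p ^ e * c) ^ m * a = aeval x F) :
    ∃ y : A, Transcendental S y ∧
      ∀ a : A, ∃ (m : ℕ) (F : S[X]), algebraMap S A c ^ m * a = aeval y F := by
  have hpA : algebraMap S A p ≠ 0 := by rwa [Ne, map_eq_zero_iff _ hinj]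
  obtain ⟨a, ha⟩ := h3
  obtain ⟨m, F, hF⟩ := hgen a
  -- The new generator is the `y` for the largest `n` such that `x` is congruent to an element of
  -- `S` modulo `p^n`.
  let Q : ℕ → Prop := fun n ↦ ∃ r y, x = algebraMap S A r + algebraMap S A (p ^ n) * y
  -- Such `n` are bounded: if `x ≡ r` modulo `p^(em+1)`, then `p^(em) c^m a = F(x)` is congruent to
  -- `F(r)` to that order. Cancelling `p^(em)` and inverting `c` modulo `p` puts `a` in `S + pA`.
  have hQ : ¬ Q (e * m + 1) := by
    rintro ⟨r, y, hxy⟩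
    obtain ⟨b, hb⟩ := sub_dvd_eval_sub x (algebraMap S A r) (F.map (algebraMap S A))
    rw [eval_map_algebraMap, eval_map_algebraMap, ← hF, aeval_algebraMap_apply_eq_algebraMap_eval,
      show x - algebraMap S A r = algebraMap S A p ^ (e * m) * (algebraMap S A p * y) by
        rw [hxy, map_pow]; ring] at hb
    have hb' : algebraMap S A (F.eval r) = algebraMap S A p ^ (e * m) *
        (algebraMap S A c ^ m * a - algebraMap S A p * (y * b)) := by
      rw [map_mul, map_pow] at hb
      linear_combination -hb
    obtain ⟨s, hs⟩ := pow_dvd_of_algebraMap_pow_dvd hp hinj h1 (e * m) _ ⟨_, hb'⟩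
    rw [hs, map_mul, map_pow] at hb'
    have hb2 := mul_left_cancel₀ (pow_ne_zero _ hpA) hb'
    obtain ⟨u, v, huv⟩ := (IsCoprime.pow_left (m := m) hc)
    have huv' := congr_arg (algebraMap S A) huv
    simp only [map_add, map_mul, map_pow, map_one] at huv'
    refine ha (u * s) ⟨algebraMap S A v * a + algebraMap S A u * (y * b), ?_⟩
    rw [map_mul]
    linear_combination (-a) * huv' - algebraMap S A u * hb2
  have hQmono : ∀ n n', n ≤ n' → Q n' → Q n := by
    rintro n n' hn ⟨r, y, h⟩
    refine ⟨r, algebraMap S A (p ^ (n' - n)) * y, ?_⟩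
    rw [h, ← mul_assoc, ← map_mul, ← pow_add, Nat.add_sub_cancel' hn]
  obtain ⟨n, ⟨r, y, hxy⟩, hn⟩ : ∃ n, Q n ∧ ¬ Q (n + 1) := by
    by_contra! hcon
    have : ∀ n, Q n := fun n ↦ by
      induction n with
      | zero => exact ⟨0, x, by simp⟩
      | succ n ih => exact hcon n ih
    exact hQ (this _)
  -- If `y` were algebraic modulo `p`, then `h2` would make it congruent to an element of `S`, and
  -- `n` could be increased.
  have hy : ∀ F : S[X], algebraMap S A p ∣ aeval y F → C p ∣ F := fun F hF ↦ by
    by_contra hnd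
    obtain ⟨r', y', hy'⟩ := h2 y F hF hnd
    refine hn ⟨r + p ^ n * r', y', ?_⟩
    rw [hxy, map_add, map_mul, pow_succ, map_mul, map_pow]
    linear_combination (algebraMap S A p) ^ n * hy'
  refine ⟨y, hx.of_add_mul hxy, fun a ↦ ?_⟩
  obtain ⟨m, F, hF⟩ := hgen a
  refine ⟨m, exists_eq_aeval_of_pow_mul_eq_aeval hp hinj hy (e * m) _
    (F.comp (C r + C (p ^ n) * X)) ?_⟩
  rw [aeval_comp, map_add, map_mul, aeval_C, aeval_C, aeval_X, ← hxy, ← hF, map_mul, map_pow]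
  ring

/-- A criterion, due to Russell and Sathaye, for an algebra over a principal ideal domain to be a
polynomial ring in one indeterminate. -/
theorem exists_transcendental_generator [IsDomain S] [IsDomain A] [IsPrincipalIdealRing S]
    (hinj : Function.Injective (algebraMap S A))
    (h1 : ∀ p : S, Prime p → ∀ s, algebraMap S A p ∣ algebraMap S A s → p ∣ s)
    (h2 : ∀ p : S, Prime p → ∀ (x : A) (F : S[X]), algebraMap S A p ∣ aeval x F → ¬ C p ∣ F →
      ∃ r, algebraMap S A p ∣ x - algebraMap S A r)
    (h3 : ∀ p : S, Prime p → ∃ a : A, ∀ r, ¬ algebraMap S A p ∣ a - algebraMap S A r)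
    (c : S) (hc : c ≠ 0) {x : A} (hx : Transcendental S x)
    (hgen : ∀ a : A, ∃ (m : ℕ) (F : S[X]), algebraMap S A c ^ m * a = aeval x F) :
    ∃ y : A, Transcendental S y ∧ ∀ a : A, ∃ F : S[X], a = aeval y F := by
  induction c using WellFounded.induction (r := DvdNotUnit (α := S))
    wellFounded_dvdNotUnit generalizing x with
  | _ c ih =>
    by_cases hu : IsUnit c
    · refine ⟨x, hx, fun a ↦ ?_⟩
      obtain ⟨m, F, hF⟩ := hgen a
      obtain ⟨d, hd⟩ := (hu.pow m).exists_left_inv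
      refine ⟨C d * F, ?_⟩
      rw [map_mul, ← hF, aeval_C, ← mul_assoc, ← map_pow, ← map_mul, hd, map_one, one_mul]
    · obtain ⟨p, hp, hpc⟩ := WfDvdMonoid.exists_irreducible_factor hu hc
      have hfin : FiniteMultiplicity p c := FiniteMultiplicity.of_not_isUnit hp.not_isUnit hc
      obtain ⟨c', hc', hpc'⟩ := hfin.exists_eq_pow_mul_and_not_dvd
      have he : multiplicity p c ≠ 0 := fun h ↦ by
        have h' := hc'
        rw [h, pow_zero, one_mul] at h'
        exact hpc' (h' ▸ hpc)
      have hcop : IsCoprime c' p := ((Irreducible.coprime_iff_not_dvd hp).2 hpc').symm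
      rw [hc'] at hgen
      obtain ⟨y, hy, hygen⟩ := exists_generator_of_prime hp.ne_zero hinj (h1 p hp.prime)
        (h2 p hp.prime) (h3 p hp.prime) hcop hx hgen
      refine ih c' ⟨?_, p ^ multiplicity p c, ?_, ?_⟩ ?_ hy hygen
      · rintro rfl
        simp at hpc'
      · rw [isUnit_pow_iff he]
        exact hp.not_isUnit
      · rw [mul_comm]
        exact hc'
      · rintro rfl
        simp at hpc'

end RussellSathaye

/-! ### Extension of scalars and transcendence degree -/

section BaseChange

open Algebra Cardinal

variable {k L A : Type*} [Field k] [Field L] [Algebra k L] [CommRing A] [Algebra k A]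

/-- Otherwise a `k`-linear form on `A` kills 1 but not `a`, and extending it to `L ⊗ A` contradicts
the equation. -/
lemma exists_algebraMap_eq_of_one_tmul_eq {a : A} {l : L} (h : (1 : L) ⊗ₜ[k] a = l ⊗ₜ[k] 1) :
    ∃ c : k, algebraMap k A c = a := by
  by_contra! hcon
  have hna : a ∉ Submodule.span k {(1 : A)} := fun ha ↦ by
    obtain ⟨c, hc⟩ := Submodule.mem_span_singleton.1 ha
    exact hcon c (by rw [← hc, Algebra.smul_def, mul_one])
  obtain ⟨g, hg, hg1⟩ := Submodule.exists_le_ker_of_notMem hna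
  have h1 : g 1 = 0 := hg1 (Submodule.mem_span_singleton_self 1)
  have h2 := congr_arg (TensorProduct.rid k L) (congr_arg (LinearMap.lTensor L g) h)
  rw [LinearMap.lTensor_tmul, LinearMap.lTensor_tmul, TensorProduct.rid_tmul,
    TensorProduct.rid_tmul, h1, zero_smul] at h2
  exact (smul_ne_zero hg one_ne_zero) h2

lemma one_tmul_injective : Function.Injective fun a : A ↦ (1 : L) ⊗ₜ[k] a :=
  Algebra.TensorProduct.includeRight_injective (FaithfulSMul.algebraMap_injective k L)

lemma AlgebraicIndependent.one_tmul {ι : Type*} {x : ι → A} (hx : AlgebraicIndependent k x) :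
    AlgebraicIndependent L fun i ↦ (1 : L) ⊗ₜ[k] x i := by
  have h1 : Function.Injective (Algebra.TensorProduct.map (AlgHom.id L L) (MvPolynomial.aeval x)) :=
    Module.Flat.lTensor_preserves_injective_linearMap (M := L)
      (MvPolynomial.aeval (R := k) x).toLinearMap hx
  have h2 : (MvPolynomial.aeval fun i ↦ (1 : L) ⊗ₜ[k] x i) =
      (Algebra.TensorProduct.map (AlgHom.id L L) (MvPolynomial.aeval x)).comp
        (MvPolynomial.algebraTensorAlgEquiv k L).symm.toAlgHom := by
    ext i
    simp
  rw [AlgebraicIndependent, h2]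
  exact h1.comp (MvPolynomial.algebraTensorAlgEquiv k L).symm.injective

lemma trdeg_le_of_isAffineForm {n : ℕ} (h : IsAffineForm n k L A) : trdeg k A ≤ n := by
  obtain ⟨e⟩ := h
  have he := e.lift_trdeg_eq
  rw [MvPolynomial.trdeg_of_isDomain, mk_fin, lift_natCast, lift_natCast, lift_eq_nat_iff] at he
  rw [trdeg]
  refine ciSup_le' fun i ↦ ?_
  have h1 := (AlgebraicIndependent.one_tmul (L := L) i.2).lift_cardinalMk_le_trdeg
  rw [he, lift_natCast, lift_le_nat_iff] at h1
  exact h1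

/-- A single generator would make `L[X]` surject onto a polynomial ring of transcendence degree two.
-/
lemma not_forall_eq_aeval_of_isAffineForm (h : IsAffineForm 2 k L A) (x : A) :
    ¬ ∀ a, ∃ F : k[X], a = Polynomial.aeval x F := by
  intro hx
  obtain ⟨e⟩ := h
  let g : L[X] →ₐ[L] L ⊗[k] A := Polynomial.aeval ((1 : L) ⊗ₜ x)
  have hg : Function.Surjective g := by
    rw [← AlgHom.range_eq_top, _root_.eq_top_iff]
    rintro b -
    induction b with
    | zero => exact zero_mem _
    | add b c hb hc => exact add_mem hb hc
    | tmul l a =>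
      obtain ⟨F, rfl⟩ := hx a
      refine ⟨Polynomial.C l * F.map (algebraMap k L), ?_⟩
      have : Polynomial.aeval ((1 : L) ⊗ₜ[k] x) F = (1 : L) ⊗ₜ[k] Polynomial.aeval x F :=
        Polynomial.aeval_algHom_apply (Algebra.TensorProduct.includeRight : A →ₐ[k] L ⊗[k] A) x F
      simp [g, this]
  have h1 := lift_trdeg_le_of_surjective (e.toAlgHom.comp g) (e.surjective.comp hg)
  rw [MvPolynomial.trdeg_of_isDomain, Polynomial.trdeg_of_isDomain] at h1
  simp at h1

end BaseChange

/-! ### One-dimensional factorially closed subalgebras -/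

section OneDimensional

open Algebra Cardinal Polynomial

variable {k A : Type*} [Field k] [CommRing A] [Algebra k A]

/-- In a subalgebra of corank at least one in an algebra of transcendence degree at most two,
any two elements are algebraically dependent. -/
lemma exists_eval₂_aeval_eq_zero [IsDomain A] (h : trdeg k A ≤ 2) (R : Subalgebra k A) {x : A}
    (hx : Transcendental R x) (f g : R) :
    ∃ P : k[X][X], P ≠ 0 ∧ P.eval₂ (aeval g : k[X] →ₐ[k] R).toRingHom f = 0 := by
  by_contra! hcon
  let ψ : k[X][X] →ₐ[k] R :=
    { eval₂RingHom (aeval g : k[X] →ₐ[k] R).toRingHom f with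
      commutes' := fun c ↦ by simp [Polynomial.algebraMap_apply] }
  have hinj : Function.Injective ψ := by
    rw [injective_iff_map_eq_zero]
    intro P hP
    by_contra hP0
    exact hcon P hP0 hP
  have h1 := lift_trdeg_le_of_injective _ hinj
  have h2 : trdeg k k[X][X] = 2 := by
    rw [← trdeg_add_eq k k[X], Polynomial.trdeg_of_isDomain, Polynomial.trdeg_of_isDomain,
      one_add_one_eq_two]
  have h3 : 1 ≤ trdeg R A := by
    have : Algebra.Transcendental R A := ⟨x, hx⟩
    exact Cardinal.one_le_iff_pos.2 (trdeg_pos R A)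
  have h4 := trdeg_add_le (R := k) (S := R) (A := A)
  rw [h2, lift_ofNat] at h1
  have h5 : (2 : Cardinal) ≤ trdeg k R := by
    rwa [← lift_le, lift_ofNat]
  have h6 := ((add_le_add h5 h3).trans h4).trans h
  have h7 : 2 + 1 ≤ 2 := by exact_mod_cast h6
  omega

/-- After powers of `X` are split off, the cofactor of `Q` takes a nonzero value at the rational
point, where `f` vanishes; so `f` divides a power of `g`. -/
lemma dvd_of_aeval_dvd {f g : A} (hf : Prime f) (ε : A →ₐ[k] k) (hεf : ε f = 0) (hεg : ε g = 0)
    {Q : k[X]} (hQ : Q ≠ 0) (h : f ∣ aeval g Q) : f ∣ g := by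
  obtain ⟨Q', hQ', hX⟩ := exists_eq_pow_rootMultiplicity_mul_and_not_dvd Q hQ 0
  rw [C_0, sub_zero] at hQ' hX
  rw [hQ', map_mul, map_pow, aeval_X] at h
  rcases hf.dvd_or_dvd h with h | h
  · exact hf.dvd_of_dvd_pow h
  · exfalso
    obtain ⟨c, hc⟩ := h
    have := congr_arg ε hc
    rw [map_mul, hεf, zero_mul, ← aeval_algHom_apply, hεg] at this
    exact hX (X_dvd_iff.2 (by rwa [coeff_zero_eq_aeval_zero]))

/-- A factorially closed subalgebra of dimension one in a factorial algebra with a rational point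
and a degree function is generated by one element. -/
lemma exists_generator_of_degree [IsDomain A] [UniqueFactorizationMonoid A] (ε : A →ₐ[k] k)
    (δ : A → ℕ)
    (hmul : ∀ a b, a ≠ 0 → b ≠ 0 → δ (a * b) = δ a + δ b)
    (hconst : ∀ a, δ a = 0 → ∃ c : k, algebraMap k A c = a)
    (hδc : ∀ c : k, δ (algebraMap k A c) = 0)
    (hsub : ∀ (a : A) (c : k), δ (a - algebraMap k A c) ≤ δ a)
    (R : Subalgebra k A) (hfc : ∀ a b, a * b ≠ 0 → a * b ∈ R → a ∈ R) (hR : R ≠ ⊥)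
    (hdep : ∀ f g : R, ∃ P : k[X][X], P ≠ 0 ∧
      P.eval₂ (aeval g : k[X] →ₐ[k] R).toRingHom f = 0) :
    ∃ f : A, (∀ Q : k[X], aeval f Q = 0 → Q = 0) ∧ ε f = 0 ∧
      ∀ a, a ∈ R ↔ ∃ Q : k[X], aeval f Q = a := by
  classical
  have hδ1 : δ 1 = 0 := by
    have := hmul 1 1 one_ne_zero one_ne_zero
    rw [mul_one] at this
    omega
  have hunit : ∀ a, IsUnit a → δ a = 0 := fun a ha ↦ by
    obtain ⟨b, hb⟩ := ha.exists_right_inv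
    have := hmul a b ha.ne_zero (right_ne_zero_of_mul (hb ▸ one_ne_zero))
    rw [hb] at this
    omega
  have hex : ∃ n a, a ∈ R ∧ δ a = n ∧ 0 < n := by
    by_contra! hcon
    refine hR (eq_bot_iff.2 fun a ha ↦ ?_)
    obtain ⟨c, rfl⟩ := hconst a (by have := hcon (δ a) a ha rfl; omega)
    exact Subalgebra.algebraMap_mem _ c
  obtain ⟨f₀, hf₀, hδf₀, hn⟩ := Nat.find_spec hex
  have hmin : ∀ a ∈ R, δ a < Nat.find hex → δ a = 0 := fun a ha hlt ↦ by
    by_contra h0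
    exact Nat.find_min hex hlt ⟨a, ha, rfl, by omega⟩
  -- Subtracting the value at the rational point keeps the degree minimal, by `hsub` in both
  -- directions.
  set f := f₀ - algebraMap k A (ε f₀) with hf
  have hfR : f ∈ R := sub_mem hf₀ (R.algebraMap_mem _)
  have hεf : ε f = 0 := by simp [hf]
  have hδf : δ f = Nat.find hex := by
    refine le_antisymm (hδf₀ ▸ hsub _ _) ?_
    have := hsub f (- ε f₀)
    rw [hf, map_neg, sub_neg_eq_add, sub_add_cancel, ← hf] at this
    omega
  have hf0 : f ≠ 0 := by
    intro h0
    have : f₀ = algebraMap k A (ε f₀) := sub_eq_zero.1 (hf ▸ h0)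
    have h := hδc (ε f₀)
    rw [← this] at h
    omega
  have hirr : Irreducible f := by
    refine ⟨fun hu ↦ by have := hunit f hu; omega, fun a b hab ↦ ?_⟩
    have hab0 : a * b ≠ 0 := hab ▸ hf0
    have ha := hfc a b hab0 (hab ▸ hfR)
    have hb := hfc b a (mul_comm a b ▸ hab0) (mul_comm a b ▸ hab ▸ hfR)
    have hd := hmul a b (left_ne_zero_of_mul hab0) (right_ne_zero_of_mul hab0)
    rw [← hab, hδf] at hd
    have key : ∀ a : A, a ≠ 0 → δ a = 0 → IsUnit a := fun a ha h ↦ by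
      obtain ⟨c, rfl⟩ := hconst a h
      exact (IsUnit.mk0 c (fun h ↦ ha (by rw [h, map_zero]))).map _
    by_cases h : δ a = 0
    · exact .inl (key a (left_ne_zero_of_mul hab0) h)
    · exact .inr (key b (right_ne_zero_of_mul hab0) (hmin b hb (by omega)))
  have hprime : Prime f := hirr.prime
  refine ⟨f, fun Q hQ ↦ ?_, hεf, fun a ↦ ⟨fun ha ↦ ?_, ?_⟩⟩
  · by_contra hQ0
    obtain ⟨Q', hQ', hX⟩ := exists_eq_pow_rootMultiplicity_mul_and_not_dvd Q hQ0 0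
    rw [C_0, sub_zero] at hQ' hX
    rw [hQ', map_mul, map_pow, aeval_X] at hQ
    have h1 := congr_arg ε ((mul_eq_zero.1 hQ).resolve_left (pow_ne_zero _ hf0))
    rw [← aeval_algHom_apply, hεf, map_zero] at h1
    exact hX (X_dvd_iff.2 (by rwa [← coeff_zero_eq_aeval_zero] at h1))
  · induction hd : δ a using Nat.strong_induction_on generalizing a with
    | _ d ih =>
      by_cases hg0 : a - algebraMap k A (ε a) = 0
      · exact ⟨C (ε a), by rw [aeval_C, sub_eq_zero.1 hg0]; simp⟩
      have hgR : a - algebraMap k A (ε a) ∈ R := sub_mem ha (R.algebraMap_mem _)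
      have hεg : ε (a - algebraMap k A (ε a)) = 0 := by simp
      obtain ⟨b, hb⟩ : f ∣ a - algebraMap k A (ε a) := by
        obtain ⟨P, hP0, hP⟩ := hdep ⟨f, hfR⟩ ⟨_, hgR⟩
        -- Once powers of the variable standing for `f` are cancelled, the constant coefficient is a
        -- nonzero polynomial in the other element, and the relation makes `f` divide its value.
        obtain ⟨P', hP', hX⟩ := exists_eq_pow_rootMultiplicity_mul_and_not_dvd P hP0 0
        rw [C_0, sub_zero] at hP' hX
        have hev : P'.eval₂ (aeval ⟨_, hgR⟩ : k[X] →ₐ[k] R).toRingHom ⟨f, hfR⟩ = 0 := by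
          rw [hP', eval₂_mul, eval₂_pow, eval₂_X] at hP
          refine (mul_eq_zero.1 hP).resolve_left (pow_ne_zero _ ?_)
          simpa [Subtype.ext_iff] using hf0
        refine dvd_of_aeval_dvd hprime ε hεf hεg (Q := P'.coeff 0)
          (fun h ↦ hX (X_dvd_iff.2 h)) ?_
        rw [← divX_mul_X_add P', eval₂_add, eval₂_mul, eval₂_X, eval₂_C] at hev
        have hev' := congr_arg R.val hev
        rw [map_add, map_mul, map_zero] at hev'
        refine ⟨-R.val (P'.divX.eval₂ (aeval ⟨_, hgR⟩ : k[X] →ₐ[k] R).toRingHom ⟨f, hfR⟩), ?_⟩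
        have h2 : R.val ((aeval (⟨_, hgR⟩ : R) : k[X] →ₐ[k] R).toRingHom (P'.coeff 0)) =
            aeval (a - algebraMap k A (ε a)) (P'.coeff 0) :=
          (aeval_algHom_apply R.val _ _).symm
        rw [← h2]
        have h3 : R.val ⟨f, hfR⟩ = f := rfl
        rw [h3] at hev'
        linear_combination hev'
      have hfb0 : f * b ≠ 0 := hb ▸ hg0
      have hb' : b ∈ R := hfc b f (mul_comm f b ▸ hfb0) (mul_comm f b ▸ hb ▸ hgR)
      have hdeg := hmul f b hf0 (right_ne_zero_of_mul hfb0)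
      have := hsub a (ε a)
      rw [← hb] at hdeg
      obtain ⟨Q, hQ⟩ := ih (δ b) (by omega) b hb' rfl
      refine ⟨X * Q + C (ε a), ?_⟩
      rw [map_add, map_mul, aeval_X, aeval_C, hQ, ← hb, sub_add_cancel]
  · rintro ⟨Q, rfl⟩
    have := Subalgebra.aeval_coe R ⟨f, hfR⟩ Q
    exact this ▸ Subtype.mem _

end OneDimensional

/-! ### Extension of scalars of an exponential map -/

section BaseChangeExponential

open Polynomial

variable {k L A : Type*} [Field k] [Field L] [Algebra k L] [CommRing A] [Algebra k A]

namespace ExponentialMap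

variable (L) (φ : ExponentialMap k A)

/-- The extension of an exponential map to `L ⊗ A`, as a homomorphism of `L`-algebras. -/
noncomputable def baseChangeHom : L ⊗[k] A →ₐ[L] (L ⊗[k] A)[X] :=
  Algebra.TensorProduct.lift (Algebra.ofId L (L ⊗[k] A)[X])
    ((mapAlgHom (Algebra.TensorProduct.includeRight : A →ₐ[k] L ⊗[k] A)).comp φ.toAlgHom)
    fun _ _ ↦ Commute.all _ _

variable {L}

lemma coeff_baseChangeHom_tmul (l : L) (a : A) (j : ℕ) :
    (φ.baseChangeHom L (l ⊗ₜ a)).coeff j = l ⊗ₜ (φ.toAlgHom a).coeff j := by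
  rw [baseChangeHom, Algebra.TensorProduct.lift_tmul, Algebra.ofId_apply,
    Polynomial.algebraMap_apply, coeff_C_mul, AlgHom.comp_apply, coe_mapAlgHom, coeff_map]
  simp

lemma coeff_zero_baseChangeHom (b : L ⊗[k] A) : (φ.baseChangeHom L b).coeff 0 = b := by
  induction b with
  | zero => simp
  | add b c hb hc => rw [map_add, coeff_add, hb, hc]
  | tmul l a => rw [coeff_baseChangeHom_tmul, φ.coeff_zero]

/-- The coordinate on `L ⊗ A` attached to a linear form on `L`. -/
noncomputable def tensorCoord (l : L →ₗ[k] k) : L ⊗[k] A →ₗ[k] A :=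
  (TensorProduct.lid k A).toLinearMap ∘ₗ LinearMap.rTensor A l

lemma coeff_toAlgHom_tensorCoord (l : L →ₗ[k] k) (b : L ⊗[k] A) (j : ℕ) :
    (φ.toAlgHom (tensorCoord l b)).coeff j = tensorCoord l ((φ.baseChangeHom L b).coeff j) := by
  induction b with
  | zero => simp
  | add b c hb hc => rw [map_add, map_add, map_add, coeff_add, coeff_add, map_add, hb, hc]
  | tmul m a =>
    rw [coeff_baseChangeHom_tmul]
    simp [tensorCoord]

lemma exists_sum_tensorCoord (b : L ⊗[k] A) : ∃ (s : Finset (Module.Basis.ofVectorSpaceIndex k L)),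
    b = ∑ i ∈ s, (Module.Basis.ofVectorSpace k L i) ⊗ₜ[k]
      tensorCoord ((Module.Basis.ofVectorSpace k L).coord i) b := by
  classical
  set v := Module.Basis.ofVectorSpace k L
  refine ⟨(TensorProduct.equivFinsuppOfBasisLeft v b).support, ?_⟩
  conv_lhs => rw [← (TensorProduct.equivFinsuppOfBasisLeft (N := A) v).symm_apply_apply b]
  rw [TensorProduct.equivFinsuppOfBasisLeft_symm_apply, Finsupp.sum]
  refine Finset.sum_congr rfl fun i _ ↦ ?_
  rw [TensorProduct.equivFinsuppOfBasisLeft_apply]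
  rfl

/-- Formation of invariants commutes with extension of scalars. -/
lemma mem_of_natDegree_baseChangeHom_eq_zero {b : L ⊗[k] A}
    (hb : (φ.baseChangeHom L b).natDegree = 0) (B : Subalgebra L (L ⊗[k] A))
    (hB : ∀ a ∈ φ.invariantSubalgebra, (1 : L) ⊗ₜ a ∈ B) : b ∈ B := by
  obtain ⟨s, hs⟩ := exists_sum_tensorCoord b
  rw [hs]
  refine sum_mem fun i _ ↦ ?_
  have h1 : tensorCoord ((Module.Basis.ofVectorSpace k L).coord i) b ∈ φ.invariantSubalgebra := by
    rw [mem_invariantSubalgebra_iff_natDegree, natDegree_eq_zero_iff_degree_le_zero,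
      degree_le_zero_iff]
    ext j
    rw [coeff_toAlgHom_tensorCoord, coeff_C]
    split_ifs with hj
    · rw [hj, coeff_toAlgHom_tensorCoord]
    · rw [coeff_eq_zero_of_natDegree_lt (by omega), map_zero]
  have h2 := B.smul_mem (hB _ h1) (Module.Basis.ofVectorSpace k L i)
  rwa [TensorProduct.smul_tmul', smul_eq_mul, mul_one] at h2

end ExponentialMap

/-- Factorial closedness of `L[f]` in `L ⊗ A`: degrees in `U` add up, so both factors have degree
zero, and such elements lie in the `L`-span of the invariants of `φ`. -/
lemma exists_eq_mul_of_aeval_eq_mul [IsDomain (L ⊗[k] A)] (φ : ExponentialMap k A) {f : A}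
    (hf : ∀ a, a ∈ φ.invariantSubalgebra ↔ ∃ Q : k[X], aeval f Q = a)
    (hft : Transcendental L ((1 : L) ⊗ₜ[k] f)) {P : L[X]} (hP : P ≠ 0) {u v : L ⊗[k] A}
    (huv : aeval ((1 : L) ⊗ₜ f) P = u * v) :
    ∃ U V : L[X], aeval ((1 : L) ⊗ₜ f) U = u ∧ aeval ((1 : L) ⊗ₜ f) V = v ∧ P = U * V := by
  have hinj : Function.Injective (φ.baseChangeHom L) := fun a b h ↦ by
    rw [← φ.coeff_zero_baseChangeHom a, h, φ.coeff_zero_baseChangeHom]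
  have hne : u * v ≠ 0 := huv ▸ fun h ↦ hP (transcendental_iff.1 hft P h)
  have hdeg : (φ.baseChangeHom L (u * v)).natDegree = 0 := by
    have : φ.baseChangeHom L ((1 : L) ⊗ₜ f) = C ((1 : L) ⊗ₜ f) := by
      ext j
      rw [φ.coeff_baseChangeHom_tmul, φ.mem_invariantSubalgebra.1 ((hf f).2 ⟨X, aeval_X _⟩),
        coeff_C, coeff_C]
      split_ifs <;> simp
    rw [← huv, ← aeval_algHom_apply, this, ← CAlgHom_apply (R := L), aeval_algHom_apply,
      CAlgHom_apply,
      natDegree_C]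
  rw [map_mul, natDegree_mul] at hdeg
  rotate_left
  · rw [Ne, map_eq_zero_iff _ hinj]
    exact left_ne_zero_of_mul hne
  · rw [Ne, map_eq_zero_iff _ hinj]
    exact right_ne_zero_of_mul hne
  have key : ∀ w, (φ.baseChangeHom L w).natDegree = 0 →
      ∃ W : L[X], aeval ((1 : L) ⊗ₜ f) W = w := fun w hw ↦ by
    have := φ.mem_of_natDegree_baseChangeHom_eq_zero hw
      (aeval ((1 : L) ⊗ₜ[k] f) : L[X] →ₐ[L] _).range fun a ha ↦ by
        obtain ⟨Q, rfl⟩ := (hf a).1 ha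
        refine ⟨Q.map (algebraMap k L), ?_⟩
        have := aeval_algHom_apply (Algebra.TensorProduct.includeRight : A →ₐ[k] L ⊗[k] A) f Q
        simpa using this
    exact this
  obtain ⟨U, hU⟩ := key u (by omega)
  obtain ⟨V, hV⟩ := key v (by omega)
  refine ⟨U, V, hU, hV, ?_⟩
  have := transcendental_iff.1 hft (P - U * V)
    (by rw [map_sub, map_mul, hU, hV, huv, sub_self])
  exact sub_eq_zero.1 this

/-- The fibres of the quotient map by an exponential map on a form of the plane are integral. -/
lemma prime_one_tmul_sub [IsDomain (L ⊗[k] A)] [UniqueFactorizationMonoid (L ⊗[k] A)]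
    (φ : ExponentialMap k A) {f : A}
    (hf : ∀ a, a ∈ φ.invariantSubalgebra ↔ ∃ Q : k[X], aeval f Q = a)
    (hft : Transcendental L ((1 : L) ⊗ₜ[k] f)) (μ : L) :
    Prime ((1 : L) ⊗ₜ[k] f - algebraMap L _ μ) := by
  refine Irreducible.prime ⟨fun hu ↦ ?_, fun u v huv ↦ ?_⟩
  · obtain ⟨v, hv⟩ := hu.exists_right_inv
    obtain ⟨U, V, hU, -, h⟩ := exists_eq_mul_of_aeval_eq_mul φ hf hft one_ne_zero
      ((map_one _).trans hv.symm)
    have h1 := transcendental_iff.1 hft (X - C μ - U)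
      (by rw [map_sub, hU, map_sub, aeval_X, aeval_C, sub_self])
    rw [← sub_eq_zero.1 h1] at h
    exact not_isUnit_X_sub_C μ (IsUnit.of_mul_eq_one _ h.symm)
  · obtain ⟨U, V, rfl, rfl, h⟩ := exists_eq_mul_of_aeval_eq_mul φ hf hft (X_sub_C_ne_zero μ)
      (u := u) (v := v) (by rw [← huv, map_sub, aeval_X, aeval_C])
    rcases (irreducible_X_sub_C μ).isUnit_or_isUnit h with h | h
    · exact .inl (h.map _)
    · exact .inr (h.map _)

end BaseChangeExponential

/-! ### Fibres over the closed points of the quotient line -/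

section Fibres

open Polynomial

variable {k L A : Type*} [Field k] [Field L] [Algebra k L] [CommRing A] [Algebra k A]

/-- This says that `k[f]/p` is algebraically closed in `A/pA`. Over a root `μ` of `p` the fibre is
an integral `L`-algebra, so an algebraic element becomes a constant there; linear algebra over the
residue field brings this down to `A/pA`. -/
lemma exists_dvd_sub_of_dvd_aeval [IsAlgClosed L] {f : A}
    (hprime : ∀ μ : L, Prime ((1 : L) ⊗ₜ[k] f - algebraMap L _ μ)) {p : k[X]} (hp : Irreducible p)
    (x : A) (F : k[X][X]) (hF : aeval f p ∣ F.eval₂ (aeval f : k[X] →ₐ[k] A).toRingHom x)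
    (hpF : ¬ C p ∣ F) : ∃ r : k[X], aeval f p ∣ x - aeval f r := by
  obtain ⟨μ, hμ⟩ := IsAlgClosed.exists_aeval_eq_zero L p (degree_pos_of_irreducible hp).ne'
  set π : L ⊗[k] A := (1 : L) ⊗ₜ[k] f - algebraMap L _ μ with hπ
  have hι (Q : k[X]) : (1 : L) ⊗ₜ[k] aeval f Q = aeval ((1 : L) ⊗ₜ[k] f) Q :=
    (aeval_algHom_apply (Algebra.TensorProduct.includeRight : A →ₐ[k] L ⊗[k] A) f Q).symm
  have hcong (Q : k[X]) : π ∣ (1 : L) ⊗ₜ[k] aeval f Q - algebraMap L _ (aeval μ Q) := by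
    rw [hι, ← aeval_algebraMap_apply, aeval_def, aeval_def, ← eval_map, ← eval_map]
    exact sub_dvd_eval_sub _ _ _
  -- the image of `x` in the fibre is a root of a nonzero polynomial, hence constant
  obtain ⟨ν, hν⟩ : ∃ ν : L, π ∣ (1 : L) ⊗ₜ[k] x - algebraMap L _ ν := by
    set G : L[X] := F.map (aeval μ : k[X] →ₐ[k] L).toRingHom with hG
    have hG0 : G ≠ 0 := by
      intro h0
      refine hpF ((C_dvd_iff_dvd_coeff _ _).2 fun i ↦ ?_)
      have h1 : aeval μ (F.coeff i) = 0 := by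
        have := congr_arg (coeff · i) h0
        simpa [hG, coeff_map] using this
      by_contra hnd
      obtain ⟨a, b, hab⟩ := (Irreducible.coprime_iff_not_dvd hp).2 hnd
      have := congr_arg (aeval μ) hab
      rw [map_add, map_mul, map_mul, hμ, h1, mul_zero, mul_zero, map_one, add_zero] at this
      exact zero_ne_one this
    have hGx : π ∣ aeval ((1 : L) ⊗ₜ[k] x) G := by
      have h1 : π ∣ (1 : L) ⊗ₜ[k] F.eval₂ (aeval f : k[X] →ₐ[k] A).toRingHom x := by
        obtain ⟨a, ha⟩ := hF
        have h2 := hcong p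
        rw [hμ, map_zero, sub_zero] at h2
        rw [ha, show (1 : L) ⊗ₜ[k] (aeval f p * a) = (1 : L) ⊗ₜ[k] aeval f p * (1 : L) ⊗ₜ[k] a by
          rw [Algebra.TensorProduct.tmul_mul_tmul, one_mul]]
        exact h2.mul_right _
      have h2 : π ∣ (1 : L) ⊗ₜ[k] F.eval₂ (aeval f : k[X] →ₐ[k] A).toRingHom x -
          aeval ((1 : L) ⊗ₜ[k] x) G := by
        have h3 : (1 : L) ⊗ₜ[k] F.eval₂ (aeval f : k[X] →ₐ[k] A).toRingHom x =
            F.sum fun i Q ↦ (1 : L) ⊗ₜ[k] aeval f Q * ((1 : L) ⊗ₜ[k] x) ^ i := by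
          rw [eval₂_eq_sum, Polynomial.sum, TensorProduct.tmul_sum]
          refine Finset.sum_congr rfl fun i _ ↦ ?_
          change _ = (1 : L) ⊗ₜ[k] aeval f (F.coeff i) * ((1 : L) ⊗ₜ[k] x) ^ i
          rw [Algebra.TensorProduct.tmul_pow, Algebra.TensorProduct.tmul_mul_tmul, one_pow, one_mul]
          rfl
        have h4 : aeval ((1 : L) ⊗ₜ[k] x) G =
            F.sum fun i Q ↦ algebraMap L _ (aeval μ Q) * ((1 : L) ⊗ₜ[k] x) ^ i := by
          rw [aeval_def, hG, eval₂_map, eval₂_eq_sum]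
          rfl
        rw [h3, h4, Polynomial.sum, Polynomial.sum, ← Finset.sum_sub_distrib]
        refine Finset.dvd_sum fun i _ ↦ ?_
        rw [← sub_mul]
        exact (hcong _).mul_right _
      exact (dvd_sub_right h1).1 h2 |> fun h ↦ by simpa using h
    rw [(IsAlgClosed.splits G).eq_prod_roots, map_mul, aeval_C] at hGx
    have h5 : ¬ π ∣ algebraMap L _ G.leadingCoeff := fun h ↦
      (hprime μ).not_isUnit (isUnit_of_dvd_unit h
        ((IsUnit.mk0 _ (leadingCoeff_ne_zero.2 hG0)).map (algebraMap L _)))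
    have h6 := ((hprime μ).dvd_or_dvd hGx).resolve_left h5
    rw [map_multiset_prod, Multiset.map_map] at h6
    obtain ⟨q, hq, hqd⟩ := (hprime μ).exists_mem_multiset_dvd h6
    obtain ⟨ν, -, rfl⟩ := Multiset.mem_map.1 hq
    exact ⟨ν, by simpa [hπ] using hqd⟩
  -- a linear form over the residue field of `p` separates `x` from the constants
  have : Fact (Irreducible p) := ⟨hp⟩
  let D := A ⧸ Ideal.span {aeval f p}
  let mk : A →+* D := Ideal.Quotient.mk _
  let ρ : AdjoinRoot p →+* D := AdjoinRoot.lift (mk.comp (algebraMap k A)) (mk f) (by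
    have : (Ideal.Quotient.mk (Ideal.span {aeval f p})) (aeval f p) = 0 :=
      Ideal.Quotient.eq_zero_iff_mem.2 (Ideal.mem_span_singleton_self _)
    rw [aeval_def, hom_eval₂] at this
    exact this)
  have hρ (Q : k[X]) : ρ (AdjoinRoot.mk p Q) = mk (aeval f Q) := by
    exact (AdjoinRoot.lift_mk ..).trans (hom_eval₂ Q (algebraMap k A) mk f).symm
  let j : AdjoinRoot p →+* L := AdjoinRoot.lift (algebraMap k L) μ hμ
  let _ : Algebra (AdjoinRoot p) D := ρ.toAlgebra
  by_contra! hcon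
  have hx : mk x ∉ Submodule.span (AdjoinRoot p) {(1 : D)} := by
    intro hx
    obtain ⟨κ, hκ⟩ := Submodule.mem_span_singleton.1 hx
    obtain ⟨r, rfl⟩ := AdjoinRoot.mk_surjective κ
    rw [Algebra.smul_def, mul_one] at hκ
    have h1 : ρ (AdjoinRoot.mk p r) = mk x := hκ
    rw [hρ, eq_comm] at h1
    exact hcon r (Ideal.mem_span_singleton.1 ((Ideal.Quotient.mk_eq_mk_iff_sub_mem _ _).1 h1))
  obtain ⟨g, hgx, hg1⟩ := Submodule.exists_le_ker_of_notMem hx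
  have hg1 : g 1 = 0 := hg1 (Submodule.mem_span_singleton_self 1)
  have hgmul (Q : k[X]) (a : A) : g (mk (aeval f Q * a)) = AdjoinRoot.mk p Q * g (mk a) := by
    rw [map_mul, ← hρ, ← smul_eq_mul (AdjoinRoot.mk p Q), ← map_smul, Algebra.smul_def]
    rfl
  have hj (Q : k[X]) : j (AdjoinRoot.mk p Q) = aeval μ Q := by
    rw [aeval_def]
    exact AdjoinRoot.lift_mk ..
  let h : A →ₗ[k] L :=
    { toFun := fun a ↦ j (g (mk a))
      map_add' := fun a b ↦ by rw [map_add, map_add, map_add]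
      map_smul' := fun c a ↦ by
        have := hgmul (C c) a
        rw [aeval_C, ← Algebra.smul_def] at this
        rw [this, map_mul, hj, aeval_C, RingHom.id_apply, Algebra.smul_def] }
  -- The `L`-linear extension of `g` kills all multiples of `π`, because `f` acts on `A/pA` as the
  -- root of `p` in the residue field, which `j` sends to `μ`.
  let Λ : L ⊗[k] A →ₗ[L] L := TensorProduct.AlgebraTensorModule.lift
    ((LinearMap.toSpanSingleton L (A →ₗ[k] L) h))
  have hΛ (l : L) (a : A) : Λ (l ⊗ₜ a) = l * j (g (mk a)) := rfl
  have hΛπ (b : L ⊗[k] A) : Λ (π * b) = 0 := by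
    induction b with
    | zero => simp
    | add b c hb hc => rw [mul_add, map_add, hb, hc, add_zero]
    | tmul l a =>
      have h1 := hgmul X a
      rw [aeval_X] at h1
      rw [hπ, sub_mul, map_sub, Algebra.TensorProduct.tmul_mul_tmul, hΛ, h1, ← Algebra.smul_def,
        map_smul, hΛ, map_mul, hj, aeval_X, smul_eq_mul]
      ring
  obtain ⟨b, hb⟩ := hν
  have h1 := congr_arg Λ hb
  rw [hΛπ, map_sub, hΛ, Algebra.algebraMap_eq_smul_one, map_smul,
    Algebra.TensorProduct.one_def, hΛ, map_one, hg1, map_zero, mul_zero, smul_zero, sub_zero,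
    one_mul, map_eq_zero_iff _ j.injective] at h1
  exact hgx h1

/-- A curve in the plane is not a point: if `A = k[f] + pA`, then every element of `L ⊗ A` is
constant modulo the prime `π`. So `π` is associated to `X₀ - ν₀` and yet divides `X₁ - ν₁`. -/
lemma exists_forall_not_dvd_sub [IsAlgClosed L] (e : L ⊗[k] A ≃ₐ[L] MvPolynomial (Fin 2) L) {f : A}
    (hprime : ∀ μ : L, Prime ((1 : L) ⊗ₜ[k] f - algebraMap L _ μ)) {p : k[X]} (hp : Irreducible p) :
    ∃ a : A, ∀ r : k[X], ¬ aeval f p ∣ a - aeval f r := by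
  by_contra! hcon
  obtain ⟨μ, hμ⟩ := IsAlgClosed.exists_aeval_eq_zero L p (degree_pos_of_irreducible hp).ne'
  set π : L ⊗[k] A := (1 : L) ⊗ₜ[k] f - algebraMap L _ μ with hπ
  have hι (Q : k[X]) : (1 : L) ⊗ₜ[k] aeval f Q = aeval ((1 : L) ⊗ₜ[k] f) Q :=
    (aeval_algHom_apply (Algebra.TensorProduct.includeRight : A →ₐ[k] L ⊗[k] A) f Q).symm
  have hcong (Q : k[X]) : π ∣ (1 : L) ⊗ₜ[k] aeval f Q - algebraMap L _ (aeval μ Q) := by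
    rw [hι, ← aeval_algebraMap_apply, aeval_def, aeval_def, ← eval_map, ← eval_map]
    exact sub_dvd_eval_sub _ _ _
  have hall (b : L ⊗[k] A) : ∃ ν : L, π ∣ b - algebraMap L _ ν := by
    induction b with
    | zero => exact ⟨0, by simp⟩
    | add b c hb hc =>
      obtain ⟨ν, hν⟩ := hb
      obtain ⟨ν', hν'⟩ := hc
      exact ⟨ν + ν', by rw [map_add, add_sub_add_comm]; exact dvd_add hν hν'⟩
    | tmul l a =>
      obtain ⟨r, s, hs⟩ := hcon a
      refine ⟨l * aeval μ r, ?_⟩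
      have h2 := hcong p
      rw [hμ, map_zero, sub_zero] at h2
      have h3 : l ⊗ₜ[k] a - algebraMap L (L ⊗[k] A) (l * aeval μ r) = algebraMap L _ l *
          (((1 : L) ⊗ₜ[k] aeval f r - algebraMap L _ (aeval μ r)) +
            (1 : L) ⊗ₜ[k] aeval f p * (1 : L) ⊗ₜ[k] s) := by
        rw [Algebra.TensorProduct.tmul_mul_tmul, ← hs, TensorProduct.tmul_sub, map_mul, mul_one,
          ← one_mul a, ← mul_one l, ← Algebra.TensorProduct.tmul_mul_tmul,
          Algebra.TensorProduct.algebraMap_apply, Algebra.algebraMap_self_apply]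
        simp only [mul_one, one_mul]
        ring
      rw [h3]
      exact (dvd_add (hcong r) (h2.mul_right _)).mul_left _
  have hall' (b : MvPolynomial (Fin 2) L) : ∃ ν : L, e π ∣ b - MvPolynomial.C ν := by
    obtain ⟨ν, hν⟩ := hall (e.symm b)
    refine ⟨ν, ?_⟩
    have := map_dvd e hν
    rwa [map_sub e (e.symm b), e.apply_symm_apply, e.commutes] at this
  have hπp : Prime (e π) := (MulEquiv.prime_iff e.toMulEquiv).2 (hprime μ)
  obtain ⟨ν₀, hν₀⟩ := hall' (MvPolynomial.X 0)
  obtain ⟨ν₁, hν₁⟩ := hall' (MvPolynomial.X 1)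
  have hirr : Irreducible (MvPolynomial.X 0 - MvPolynomial.C ν₀ : MvPolynomial (Fin 2) L) := by
    have := MvPolynomial.irreducible_mul_X_add (1 : MvPolynomial (Fin 2) L) (-MvPolynomial.C ν₀) 0
      one_ne_zero (by simp) (by rw [← map_neg, MvPolynomial.vars_C]; simp) isRelPrime_one_left
    rwa [one_mul, ← sub_eq_add_neg] at this
  have hass := hπp.irreducible.associated_of_dvd hirr hν₀
  obtain ⟨q, hq⟩ := hass.dvd_iff_dvd_left.1 hν₁
  -- At this point `X₀ - ν₀` vanishes and `X₁ - ν₁` equals 1.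
  have := congr_arg (MvPolynomial.eval ![ν₀, ν₁ + 1]) hq
  simp at this

end Fibres

/-! ### From generators to the polynomial ring, and the main theorem -/

section PolynomialRingCriterion

open Polynomial

/-- The two standard models of the polynomial ring in two indeterminates. -/
noncomputable def mvPolynomialFinTwoEquiv (R : Type*) [CommRing R] :
    MvPolynomial (Fin 2) R ≃ₐ[R] R[X][X] :=
  (MvPolynomial.finSuccEquiv R 1).trans (mapAlgEquiv (MvPolynomial.uniqueAlgEquiv R (Fin 1)))

lemma IsPolynomialRing.of_generators {k A : Type*} [Field k] [CommRing A] [Algebra k A]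
    [Algebra k[X] A] [IsScalarTower k k[X] A] {y : A} (hy : Transcendental k[X] y)
    (hgen : ∀ a : A, ∃ F : k[X][X], a = aeval y F) : IsPolynomialRing 2 k A := by
  refine ⟨(AlgEquiv.ofBijective ((aeval y : k[X][X] →ₐ[k[X]] A).restrictScalars k)
    ⟨?_, fun a ↦ ?_⟩).symm.trans (mvPolynomialFinTwoEquiv k).symm⟩
  · rw [injective_iff_map_eq_zero]
    exact transcendental_iff.1 hy
  · obtain ⟨F, hF⟩ := hgen a
    exact ⟨F, hF.symm⟩

end PolynomialRingCriterion

section Main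

open Polynomial

variable {k L A : Type*} [Field k] [Field L] [Algebra k L] [CommRing A] [Algebra k A]

lemma ExponentialMap.invariantSubalgebra_ne_bot [IsDomain A] (h : IsAffineForm 2 k L A)
    (φ : ExponentialMap k A) {x : A} (hx : φ.IsLocalSlice x) : φ.invariantSubalgebra ≠ ⊥ := by
  intro hbot
  have hS : ∀ a, a ∈ φ.invariantSubalgebra ↔ a ∈ Set.range (algebraMap k A) := fun a ↦ by
    rw [hbot]
    exact Algebra.mem_bot
  obtain ⟨c, hc⟩ := (hS _).1 (ExponentialMap.leadingCoeff_mem x)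
  have hc0 : c ≠ 0 := by
    rintro rfl
    exact hx.leadingCoeff_ne_zero (by rw [← hc, map_zero])
  refine not_forall_eq_aeval_of_isAffineForm h x fun a ↦ ?_
  obtain ⟨m, F, hF⟩ := hx.exists_pow_mul_eq_aeval hS a
  refine ⟨C (c ^ m)⁻¹ * F, ?_⟩
  rw [map_mul, ← hF, aeval_C, ← hc, ← map_pow, ← mul_assoc, ← map_mul,
    inv_mul_cancel₀ (pow_ne_zero _ hc0), map_one, one_mul]

/-- The degree function is total degree after extension to `L`; an element of degree zero lies in `A
∩ L = k`. -/
lemma exists_generator_of_invariants [IsDomain A] [UniqueFactorizationMonoid A]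
    (h : IsAffineForm 2 k L A) (ε : A →ₐ[k] k) (φ : ExponentialMap k A) {x : A}
    (hx : φ.IsLocalSlice x) :
    ∃ f : A, (∀ Q : k[X], aeval f Q = 0 → Q = 0) ∧
      ∀ a, a ∈ φ.invariantSubalgebra ↔ ∃ Q : k[X], aeval f Q = a := by
  have htr := trdeg_le_of_isAffineForm h
  have hne := φ.invariantSubalgebra_ne_bot h hx
  obtain ⟨e⟩ := h
  have hι (a b : A) : e ((1 : L) ⊗ₜ (a * b)) = e ((1 : L) ⊗ₜ a) * e ((1 : L) ⊗ₜ b) := by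
    rw [← map_mul, Algebra.TensorProduct.tmul_mul_tmul, one_mul]
  have hι0 (a : A) (ha : a ≠ 0) : e ((1 : L) ⊗ₜ[k] a) ≠ 0 := by
    rw [Ne, map_eq_zero_iff _ e.injective]
    intro h0
    exact ha (one_tmul_injective (L := L) (k := k) (by simpa using h0))
  have hιc (c : k) : e ((1 : L) ⊗ₜ[k] algebraMap k A c) = MvPolynomial.C (algebraMap k L c) := by
    have := e.commutes (algebraMap k L c)
    rw [MvPolynomial.algebraMap_eq] at this
    rw [← this, Algebra.TensorProduct.algebraMap_apply, Algebra.algebraMap_self_apply,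
      Algebra.algebraMap_eq_smul_one, Algebra.algebraMap_eq_smul_one, TensorProduct.tmul_smul,
      TensorProduct.smul_tmul']
  obtain ⟨f, hf, -, hfR⟩ := exists_generator_of_degree ε
    (fun a ↦ (e ((1 : L) ⊗ₜ[k] a)).totalDegree)
    (fun a b ha hb ↦ by
      rw [hι, MvPolynomial.totalDegree_mul_of_isDomain (hι0 a ha) (hι0 b hb)])
    (fun a ha ↦ by
      have h1 := MvPolynomial.totalDegree_eq_zero_iff_eq_C.1 ha
      rw [← MvPolynomial.algebraMap_eq, ← e.commutes] at h1
      exact exists_algebraMap_eq_of_one_tmul_eq (e.injective h1))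
    (fun c ↦ by rw [hιc, MvPolynomial.totalDegree_C])
    (fun a c ↦ by
      rw [TensorProduct.tmul_sub, map_sub, hιc]
      exact MvPolynomial.totalDegree_sub_C_le _ _)
    φ.invariantSubalgebra (fun a b ↦ φ.mem_invariantSubalgebra_of_mul_mem) hne
    (exists_eval₂_aeval_eq_zero htr _
      (hx.transcendental (S := φ.invariantSubalgebra) (by simp) Subtype.val_injective))
  exact ⟨f, hf, hfR⟩

lemma isPolynomialRing_of_isAlgClosed [IsAlgClosed L] (h : IsAffineForm 2 k L A) (hA : IsUFD A)
    (hpt : HasRationalPoint k A) (hφ : IsNonRigid k A) : IsPolynomialRing 2 k A := by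
  obtain ⟨_, _⟩ := hA
  obtain ⟨ε⟩ := hpt
  obtain ⟨φ, hφ⟩ := hφ
  obtain ⟨x, hx⟩ := φ.exists_isLocalSlice hφ
  obtain ⟨f, hf, hfR⟩ := exists_generator_of_invariants h ε φ hx
  obtain ⟨e⟩ := h
  have : IsDomain (L ⊗[k] A) := e.toMulEquiv.isDomain
  have : UniqueFactorizationMonoid (L ⊗[k] A) :=
    e.symm.toMulEquiv.uniqueFactorizationMonoid inferInstance
  have hft : Transcendental L ((1 : L) ⊗ₜ[k] f) := by
    have h1 : AlgebraicIndependent k fun _ : Unit ↦ f :=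
      algebraicIndependent_unique_type_iff.2 (transcendental_iff.2 hf)
    exact algebraicIndependent_unique_type_iff.1 (h1.one_tmul (L := L))
  have hprime := prime_one_tmul_sub φ hfR hft
  let _ : Algebra k[X] A := (aeval f : k[X] →ₐ[k] A).toRingHom.toAlgebra
  have hmap (Q : k[X]) : algebraMap k[X] A Q = aeval f Q := rfl
  have : IsScalarTower k k[X] A := .of_algebraMap_eq fun c ↦ by
    rw [hmap, Polynomial.algebraMap_apply, aeval_C, Algebra.algebraMap_self_apply]
  have hinj : Function.Injective (algebraMap k[X] A) :=
    (injective_iff_map_eq_zero _).2 hf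
  have hS : ∀ a, a ∈ φ.invariantSubalgebra ↔ a ∈ Set.range (algebraMap k[X] A) := hfR
  obtain ⟨c, hc⟩ := (hS _).1 (ExponentialMap.leadingCoeff_mem x)
  have hc0 : c ≠ 0 := by
    rintro rfl
    exact hx.leadingCoeff_ne_zero (by rw [← hc, map_zero])
  obtain ⟨y, hy, hgen⟩ := exists_transcendental_generator (S := k[X]) (A := A) hinj
    -- Since `s` is invariant, factorial closedness makes its cofactor `a` invariant, that is, a
    -- polynomial in `f`.
    (fun p hp s ⟨a, ha⟩ ↦ by
      rcases eq_or_ne s 0 with rfl | hs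
      · exact dvd_zero p
      have hne : a * algebraMap k[X] A p ≠ 0 := by
        rw [mul_comm, ← ha, Ne, map_eq_zero_iff _ hinj]
        exact hs
      obtain ⟨r, rfl⟩ := (hS a).1 (φ.mem_invariantSubalgebra_of_mul_mem hne
        (by rw [mul_comm, ← ha]; exact (hS _).2 ⟨s, rfl⟩))
      exact ⟨r, hinj (by rw [ha, map_mul])⟩)
    (fun p hp x F hF hpF ↦ exists_dvd_sub_of_dvd_aeval hprime hp.irreducible x F hF hpF)
    (fun p hp ↦ exists_forall_not_dvd_sub e hprime hp.irreducible)
    c hc0 (hx.transcendental hS hinj)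
    (fun a ↦ hc ▸ hx.exists_pow_mul_eq_aeval hS a)
  exact .of_generators hy hgen

lemma IsAffineForm.extend {n : ℕ} (M : Type*) [Field M] [Algebra k M] [Algebra L M]
    [IsScalarTower k L M] (h : IsAffineForm n k L A) : IsAffineForm n k M A := by
  obtain ⟨e⟩ := h
  exact ⟨(Algebra.TensorProduct.cancelBaseChange k L M M A).symm.trans
    ((Algebra.TensorProduct.congr .refl e).trans (MvPolynomial.algebraTensorAlgEquiv L M))⟩

/-- A factorial and non-rigid form of the plane with a rational point is trivial. -/
theorem isPolynomialRing_of_isAffineForm (h : IsAffineForm 2 k L A) (hA : IsUFD A)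
    (hpt : HasRationalPoint k A) (hφ : IsNonRigid k A) : IsPolynomialRing 2 k A :=
  isPolynomialRing_of_isAlgClosed (h.extend (AlgebraicClosure L)) hA hpt hφ

end Main

/-! ### Extension of derivations to fractions and polynomials -/

section Derivations

/-- A section of `R[ε] → R` is a derivation of `R`. -/
noncomputable def Derivation.ofTrivSqZeroExt {R : Type*} [CommRing R]
    (σ : R →+* TrivSqZeroExt R R) (hσ : ∀ r, (σ r).fst = r) : Derivation ℤ R R :=
  Derivation.mk' ((TrivSqZeroExt.sndHom R R).toAddMonoidHom.comp σ.toAddMonoidHom).toIntLinearMap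
    fun a b ↦ by
      change (σ (a * b)).snd = a • (σ b).snd + b • (σ a).snd
      rw [map_mul, TrivSqZeroExt.snd_mul, hσ, hσ, op_smul_eq_smul]

@[simp]
lemma Derivation.ofTrivSqZeroExt_apply {R : Type*} [CommRing R]
    (σ : R →+* TrivSqZeroExt R R) (hσ : ∀ r, (σ r).fst = r) (r : R) :
    Derivation.ofTrivSqZeroExt σ hσ r = (σ r).snd := rfl

/-- The section of `S[ε] → S` over `R` given by a derivation of `R`. -/
noncomputable def Derivation.toTrivSqZeroExt {R S : Type*} [CommRing R] [CommRing S] [Algebra R S]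
    (d : Derivation ℤ R R) : R →+* TrivSqZeroExt S S where
  toFun r := .inl (algebraMap R S r) + .inr (algebraMap R S (d r))
  map_one' := by simp
  map_zero' := by simp
  map_add' a b := by ext <;> simp [-DualNumber.inr_eq_smul_eps]
  map_mul' a b := by
    ext
    · simp
    · simp [-DualNumber.inr_eq_smul_eps, mul_comm]

/-- The extension of a derivation to the field of fractions. -/
noncomputable def Derivation.toFractionRing {R : Type*} (K : Type*) [CommRing R] [IsDomain R]
    [Field K] [Algebra R K] [IsFractionRing R K] (d : Derivation ℤ R R) : Derivation ℤ K K :=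
  have h : ∀ y : nonZeroDivisors R, IsUnit (d.toTrivSqZeroExt (S := K) y) := fun y ↦ by
    rw [TrivSqZeroExt.isUnit_iff_isUnit_fst]
    simp [Derivation.toTrivSqZeroExt]
  Derivation.ofTrivSqZeroExt (IsLocalization.lift h) fun r ↦ by
    have : (TrivSqZeroExt.fstHom K K K).toRingHom.comp (IsLocalization.lift h) = RingHom.id K := by
      refine IsLocalization.ringHom_ext (nonZeroDivisors R) ?_
      ext r
      simp [Derivation.toTrivSqZeroExt]
    exact congr($this r)

lemma Derivation.toFractionRing_algebraMap {R : Type*} (K : Type*) [CommRing R] [IsDomain R]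
    [Field K] [Algebra R K] [IsFractionRing R K] (d : Derivation ℤ R R) (r : R) :
    d.toFractionRing K (algebraMap R K r) = algebraMap R K (d r) := by
  rw [Derivation.toFractionRing, Derivation.ofTrivSqZeroExt_apply, IsLocalization.lift_eq]
  simp [Derivation.toTrivSqZeroExt, -DualNumber.inr_eq_smul_eps]

/-- The section of `S[ε] → S` over a polynomial ring `S` corresponding to
`Derivation.extendMvPolynomial`. -/
noncomputable def Derivation.sectionMvPolynomial {σ R : Type*} [CommRing R] (d : Derivation ℤ R R)
    (F : σ → MvPolynomial σ R) :
    MvPolynomial σ R →+* TrivSqZeroExt (MvPolynomial σ R) (MvPolynomial σ R) :=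
  MvPolynomial.eval₂Hom d.toTrivSqZeroExt fun i ↦ .inl (.X i) + .inr (F i)

/-- The derivation of a polynomial ring that extends a given derivation of the coefficients and
takes given values at the indeterminates. -/
noncomputable def Derivation.extendMvPolynomial {σ R : Type*} [CommRing R] (d : Derivation ℤ R R)
    (F : σ → MvPolynomial σ R) : Derivation ℤ (MvPolynomial σ R) (MvPolynomial σ R) :=
  Derivation.ofTrivSqZeroExt (d.sectionMvPolynomial F) fun r ↦ by
      have : (TrivSqZeroExt.fstHom (MvPolynomial σ R) (MvPolynomial σ R)
          (MvPolynomial σ R)).toRingHom.comp (d.sectionMvPolynomial F) = RingHom.id _ := by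
        ext <;> simp [Derivation.sectionMvPolynomial, Derivation.toTrivSqZeroExt]
      exact congr($this r)

section

variable {σ R : Type*} [CommRing R] (d : Derivation ℤ R R) (F : σ → MvPolynomial σ R)

@[simp]
lemma Derivation.extendMvPolynomial_C (r : R) :
    d.extendMvPolynomial F (.C r) = .C (d r) := by
  change TrivSqZeroExt.snd (d.sectionMvPolynomial F (.C r)) = _
  simp [Derivation.sectionMvPolynomial, Derivation.toTrivSqZeroExt, -DualNumber.inr_eq_smul_eps]

@[simp]
lemma Derivation.extendMvPolynomial_X (i : σ) : d.extendMvPolynomial F (.X i) = F i := by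
  change TrivSqZeroExt.snd (d.sectionMvPolynomial F (.X i)) = _
  simp [Derivation.sectionMvPolynomial, -DualNumber.inr_eq_smul_eps]

/-- If the values at the indeterminates have degree at most two, the derivation raises degrees by
at most one. -/
lemma Derivation.totalDegree_extendMvPolynomial_le [IsDomain R] (hF : ∀ i, (F i).totalDegree ≤ 2)
    (p : MvPolynomial σ R) :
    (d.extendMvPolynomial F p).totalDegree ≤ p.totalDegree + 1 := by
  set D := d.extendMvPolynomial F
  have hmul : ∀ (p q : MvPolynomial σ R) (m n : ℕ), p.totalDegree ≤ m → q.totalDegree ≤ n →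
      (D p).totalDegree ≤ m + 1 → (D q).totalDegree ≤ n + 1 →
      (p * q).totalDegree ≤ m + n ∧ (D (p * q)).totalDegree ≤ m + n + 1 := by
    intro p q m n hp hq hDp hDq
    refine ⟨(MvPolynomial.totalDegree_mul _ _).trans (by omega), ?_⟩
    rw [D.leibniz, smul_eq_mul, smul_eq_mul]
    refine (MvPolynomial.totalDegree_add _ _).trans (max_le ?_ ?_)
    · exact (MvPolynomial.totalDegree_mul _ _).trans (by omega)
    · exact (MvPolynomial.totalDegree_mul _ _).trans (by omega)
  have hpow : ∀ (i : σ) (n : ℕ), (MvPolynomial.X i ^ n : MvPolynomial σ R).totalDegree ≤ n ∧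
      (D (MvPolynomial.X i ^ n)).totalDegree ≤ n + 1 := by
    intro i n
    induction n with
    | zero => simp
    | succ n ih =>
      rw [pow_succ]
      exact hmul _ _ n 1 ih.1 (by simp) ih.2 (by
        rw [Derivation.extendMvPolynomial_X]
        exact hF i)
  have hmon : ∀ m : σ →₀ ℕ, (MvPolynomial.monomial m (1 : R)).totalDegree ≤ m.degree ∧
      (D (MvPolynomial.monomial m (1 : R))).totalDegree ≤ m.degree + 1 := by
    intro m
    induction m using Finsupp.induction_linear with
    | zero =>
      have : (MvPolynomial.monomial (0 : σ →₀ ℕ)) (1 : R) = 1 := rfl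
      simp [this]
    | add m n hm hn =>
      have : MvPolynomial.monomial (m + n) (1 : R) =
          MvPolynomial.monomial m 1 * MvPolynomial.monomial n 1 := by
        rw [MvPolynomial.monomial_mul, mul_one]
      rw [this, map_add]
      exact hmul _ _ _ _ hm.1 hn.1 hm.2 hn.2
    | single i n =>
      rw [← MvPolynomial.X_pow_eq_monomial, Finsupp.degree_single]
      exact hpow i n
  conv_lhs => rw [p.as_sum, map_sum]
  refine MvPolynomial.totalDegree_finsetSum_le fun m hm ↦ ?_
  rw [← mul_one (p.coeff m), ← MvPolynomial.C_mul_monomial]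
  have h := (hmul (.C (p.coeff m)) (.monomial m 1) 0 m.degree (by simp) (hmon m).1
    (by rw [Derivation.extendMvPolynomial_C]; simp) (hmon m).2).2
  have h' : m.degree ≤ p.totalDegree := MvPolynomial.le_totalDegree hm
  omega

/-- In characteristic two the square of a derivation is a derivation, so it suffices to check the
coefficients and the indeterminates. -/
lemma Derivation.comp_self_extendMvPolynomial [CharP R 2] (hd : ∀ r, d (d r) = 0)
    (hF : ∀ i, d.extendMvPolynomial F (F i) = 0) (p : MvPolynomial σ R) :
    d.extendMvPolynomial F (d.extendMvPolynomial F p) = 0 := by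
  induction p using MvPolynomial.induction_on with
  | C r => rw [extendMvPolynomial_C, extendMvPolynomial_C, hd, map_zero]
  | add p q hp hq => rw [map_add, map_add, hp, hq, add_zero]
  | mul_X p i hp =>
    rw [leibniz, map_add, extendMvPolynomial_X, smul_eq_mul, smul_eq_mul, leibniz, leibniz, hF, hp,
      extendMvPolynomial_X, smul_zero, smul_zero, smul_eq_mul, smul_eq_mul]
    linear_combination (F i * d.extendMvPolynomial F p) *
      CharTwo.two_eq_zero (R := MvPolynomial σ R)

end

lemma MvPolynomial.eq_of_totalDegree_le_one {σ R : Type*} [Fintype σ] [CommRing R]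
    {p : MvPolynomial σ R} (hp : p.totalDegree ≤ 1) :
    p = C (p.coeff 0) + ∑ i, C (p.coeff (Finsupp.single i 1)) * X i := by
  classical
  ext m
  rw [coeff_add, coeff_C, coeff_sum]
  simp only [coeff_C_mul, coeff_X]
  rcases lt_trichotomy m.degree 1 with h | h | h
  · have hm : m = 0 := by rwa [← Finsupp.degree_eq_zero_iff, ← Nat.lt_one_iff]
    subst hm
    simp
  · obtain ⟨i, rfl⟩ : ∃ i, m = Finsupp.single i 1 := by
      have h' : m ∈ {d : σ →₀ ℕ | d.degree = 1} := h
      rw [← Finsupp.range_single_one] at h'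
      obtain ⟨i, hi⟩ := h'
      exact ⟨i, hi.symm⟩
    simp [Finsupp.single_left_inj, eq_comm]
  · have h0 : m ≠ 0 := by rintro rfl; simp at h
    have h1 : ∀ i, Finsupp.single i 1 ≠ m := by rintro i rfl; simp at h
    have h2 : p.coeff m = 0 := coeff_eq_zero_of_totalDegree_lt (hp.trans_lt h)
    simp [h0.symm, h1, h2]

end Derivations

/-! ### Descent along a derivation in characteristic two -/

namespace Derivation

section Descent

variable {L : Type*} [Field L]

/-- The field of constants of a derivation. -/
def constants (d : Derivation ℤ L L) : Subfield L where
  carrier := {l | d l = 0}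
  mul_mem' {a b} (ha : d a = 0) (hb : d b = 0) := by
    change d (a * b) = 0
    rw [leibniz, ha, hb, smul_zero, smul_zero, add_zero]
  one_mem' := d.map_one_eq_zero
  add_mem' {a b} (ha : d a = 0) (hb : d b = 0) := by
    change d (a + b) = 0
    rw [map_add, ha, hb, add_zero]
  zero_mem' := map_zero d
  neg_mem' {a} (ha : d a = 0) := by
    change d (-a) = 0
    rw [map_neg, ha, neg_zero]
  inv_mem' a (ha : d a = 0) := by
    change d a⁻¹ = 0
    rw [leibniz_inv, ha, smul_zero]

variable {d : Derivation ℤ L L}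

variable {k : Type*} [Field k] [Algebra k L]
  {B : Type*} [CommRing B] [Algebra L B] [Algebra k B] [IsScalarTower k L B] {D : Derivation ℤ B B}
  (hk : ∀ l, d l = 0 ↔ l ∈ Set.range (algebraMap k L))
  (hD : ∀ l, D (algebraMap L B l) = algebraMap L B (d l))

/-- The kernel of a derivation that extends a derivation of the field `L`, as an algebra over the
field of constants. -/
def kernel : Subalgebra k B where
  carrier := {b | D b = 0}
  mul_mem' {a b} (ha : D a = 0) (hb : D b = 0) := by
    change D (a * b) = 0
    rw [leibniz, ha, hb, smul_zero, smul_zero, add_zero]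
  add_mem' {a b} (ha : D a = 0) (hb : D b = 0) := by
    change D (a + b) = 0
    rw [map_add, ha, hb, add_zero]
  algebraMap_mem' r := by
    change D _ = 0
    rw [IsScalarTower.algebraMap_apply k L B, hD, (hk _).2 ⟨r, rfl⟩, map_zero]

lemma mem_kernel {b : B} : b ∈ kernel hk hD ↔ D b = 0 := Iff.rfl

section Equiv

variable {s : L} (hs : d s = 1) (hd : ∀ l, d (d l) = 0) (hDD : ∀ b, D (D b) = 0)

lemma map_smul_eq {L B : Type*} [Field L] [CommRing B] [Algebra L B] {d : Derivation ℤ L L}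
    {D : Derivation ℤ B B} (hD : ∀ l, D (algebraMap L B l) = algebraMap L B (d l)) (l : L) (b : B) :
    D (l • b) = l • D b + d l • b := by
  rw [Algebra.smul_def, leibniz, hD, smul_eq_mul, smul_eq_mul, Algebra.smul_def,
    Algebra.smul_def, mul_comm b]

include hs hDD in
lemma add_smul_mem_kernel [CharP L 2] (b : B) : b + s • D b ∈ kernel hk hD := by
  rw [mem_kernel, map_add, map_smul_eq hD, hDD, hs, smul_zero, zero_add, one_smul,
    ← two_smul L, CharTwo.two_eq_zero, zero_smul]

include hs hd hDD in
/-- Descent along a purely inseparable extension of degree two. -/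
lemma bijective_kernel_baseChange [CharP L 2] : Function.Bijective
    (Algebra.TensorProduct.lift (Algebra.ofId L B) (kernel hk hD).val
      fun _ _ ↦ Commute.all _ _) := by
  -- The coordinates in the basis `1, s` of `L` over `k` are `l + s d(l)` and `d(l)`, both
  -- constants.
  have hL (l : L) : ∃ a b : k, l = algebraMap _ L a + algebraMap _ L b * s := by
    obtain ⟨b, hb⟩ := (hk _).1 (hd l)
    obtain ⟨a, ha⟩ := (hk (l + s * d l)).1 (by
      rw [map_add, leibniz, hd, hs, smul_zero, smul_eq_mul, mul_one, zero_add,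
        CharTwo.add_self_eq_zero])
    refine ⟨a, b, ?_⟩
    rw [ha, hb]
    linear_combination -(s * d l) * CharTwo.two_eq_zero (R := L)
  have hrep (t : L ⊗[k] kernel hk hD) : ∃ a b : kernel hk hD, t = 1 ⊗ₜ a + s ⊗ₜ b := by
    induction t with
    | zero => exact ⟨0, 0, by simp⟩
    | add t u ht hu =>
      obtain ⟨a, b, rfl⟩ := ht
      obtain ⟨a', b', rfl⟩ := hu
      exact ⟨a + a', b + b', by rw [TensorProduct.tmul_add, TensorProduct.tmul_add]; abel⟩
    | tmul l x =>
      obtain ⟨a, b, rfl⟩ := hL l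
      refine ⟨a • x, b • x, ?_⟩
      rw [TensorProduct.add_tmul, ← Algebra.smul_def, ← TensorProduct.smul_tmul,
        ← TensorProduct.smul_tmul, Algebra.algebraMap_eq_smul_one]
  constructor
  · rw [injective_iff_map_eq_zero]
    intro t ht
    obtain ⟨a, b, rfl⟩ := hrep t
    rw [map_add, Algebra.TensorProduct.lift_tmul, Algebra.TensorProduct.lift_tmul, map_one, one_mul,
      Algebra.ofId_apply, ← Algebra.smul_def] at ht
    change (a : B) + s • (b : B) = 0 at ht
    have h1 := congr_arg D ht
    rw [map_add, map_smul_eq hD, (mem_kernel hk hD).1 a.2, (mem_kernel hk hD).1 b.2, hs, map_zero,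
      smul_zero, zero_add, zero_add, one_smul] at h1
    rw [h1, smul_zero, add_zero] at ht
    rw [show a = 0 from Subtype.ext ht, show b = 0 from Subtype.ext h1, TensorProduct.tmul_zero,
      TensorProduct.tmul_zero, add_zero]
  · intro b
    refine ⟨1 ⊗ₜ ⟨b + s • D b, add_smul_mem_kernel hk hD hs hDD b⟩ + s ⊗ₜ ⟨D b, hDD b⟩, ?_⟩
    rw [map_add, Algebra.TensorProduct.lift_tmul, Algebra.TensorProduct.lift_tmul, map_one, one_mul,
      Algebra.ofId_apply, ← Algebra.smul_def]
    change b + s • D b + s • D b = b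
    rw [add_assoc, ← two_smul L (s • D b), CharTwo.two_eq_zero, zero_smul, add_zero]

/-- The kernel of `D` is an `L`-form of `B`. -/
noncomputable def kernelBaseChangeEquiv [CharP L 2] : L ⊗[k] kernel hk hD ≃ₐ[L] B :=
  .ofBijective _ (bijective_kernel_baseChange hk hD hs hd hDD)

end Equiv

end Descent

section Factorial

variable {B : Type*} [CommRing B] {D : Derivation ℤ B B}

lemma map_eq_zero_of_map_mul_eq_zero [IsDomain B] {a b : B} (ha : a ≠ 0) (hDa : D a = 0)
    (hab : D (a * b) = 0) : D b = 0 := by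
  rw [leibniz, hDa, smul_zero, add_zero, smul_eq_mul] at hab
  exact (mul_eq_zero.1 hab).resolve_left ha

lemma map_sq_eq_zero [CharP B 2] (b : B) : D (b ^ 2) = 0 := by
  rw [sq, leibniz, CharTwo.add_self_eq_zero]

/-- A prime that does not divide its derivative divides constants to even powers only. -/
lemma sq_dvd_of_dvd {q : B} (hq : Prime q) (hqD : ¬ q ∣ D q) {a : B} (ha : D a = 0) (h : q ∣ a) :
    q ^ 2 ∣ a := by
  obtain ⟨b, rfl⟩ := h
  rw [leibniz, smul_eq_mul, smul_eq_mul] at ha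
  have h1 : q ∣ b * D q := ⟨-D b, by linear_combination ha⟩
  obtain ⟨c, rfl⟩ := (hq.dvd_or_dvd h1).resolve_right hqD
  exact ⟨c, by ring⟩

variable {k L : Type*} [Field k] [Field L] [Algebra k L] {d : Derivation ℤ L L} [Algebra L B]
  [Algebra k B] [IsScalarTower k L B] (hk : ∀ l, d l = 0 ↔ l ∈ Set.range (algebraMap k L))
  (hD : ∀ l, D (algebraMap L B l) = algebraMap L B (d l))

lemma kernel_dvd_iff [IsDomain B] {a b : kernel hk hD} : a ∣ b ↔ (a : B) ∣ b := by
  refine ⟨fun ⟨c, hc⟩ ↦ ⟨c, congr_arg Subtype.val hc⟩, fun ⟨c, hc⟩ ↦ ?_⟩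
  rcases eq_or_ne (a : B) 0 with ha | ha
  · refine ⟨0, Subtype.ext ?_⟩
    rw [hc, ha, zero_mul]
    simp
  · have := (mem_kernel hk hD).1 b.2
    rw [hc] at this
    exact ⟨⟨c, map_eq_zero_of_map_mul_eq_zero ha ((mem_kernel hk hD).1 a.2) this⟩, Subtype.ext hc⟩

lemma kernel_isUnit_iff [IsDomain B] {a : kernel hk hD} : IsUnit a ↔ IsUnit (a : B) := by
  rw [isUnit_iff_dvd_one, isUnit_iff_dvd_one, kernel_dvd_iff]
  rfl

/-- A special case of Samuel's theory of radical descent: the kernel of a derivation of a factorial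
domain is factorial if every prime whose logarithmic derivative is integral is a constant up to
a unit. -/
theorem uniqueFactorizationMonoid_kernel [IsDomain B] [CharP B 2] [UniqueFactorizationMonoid B]
    (hlog : ∀ q : B, Prime q → q ∣ D q → ∃ u : B, IsUnit u ∧ D (u * q) = 0) :
    UniqueFactorizationMonoid (kernel hk hD) := by
  -- The prime of the kernel below `q` is a unit multiple of `q` if `q` divides `D q`, and `q²`
  -- otherwise.
  have hprime : ∀ q : B, Prime q → ∀ a : kernel hk hD, q ∣ a →
      ∃ p : kernel hk hD, Prime p ∧ p ∣ a := by
    intro q hq a ha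
    by_cases hqD : q ∣ D q
    · obtain ⟨u, hu, huq⟩ := hlog q hq hqD
      have hass : Associated q (u * q) := (associated_unit_mul_left q u hu).symm
      have hp : Prime (u * q) := hass.prime hq
      refine ⟨⟨u * q, huq⟩, ⟨fun h ↦ hp.ne_zero (congr_arg Subtype.val h),
        fun h ↦ hp.not_isUnit ((kernel_isUnit_iff hk hD).1 h), fun x y hxy ↦ ?_⟩,
        (kernel_dvd_iff hk hD).2 (hass.dvd_iff_dvd_left.1 ha)⟩
      rw [kernel_dvd_iff hk hD] at hxy ⊢
      rw [kernel_dvd_iff hk hD]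
      exact hp.dvd_or_dvd hxy
    · refine ⟨⟨q ^ 2, map_sq_eq_zero q⟩, ⟨fun h ↦ ?_, fun h ↦ ?_, fun x y hxy ↦ ?_⟩,
        (kernel_dvd_iff hk hD).2 (sq_dvd_of_dvd hq hqD ((mem_kernel hk hD).1 a.2) ha)⟩
      · exact pow_ne_zero 2 hq.ne_zero (congr_arg Subtype.val h)
      · exact hq.not_isUnit ((isUnit_pow_iff two_ne_zero).1 ((kernel_isUnit_iff hk hD).1 h))
      · rw [kernel_dvd_iff hk hD] at hxy ⊢
        rw [kernel_dvd_iff hk hD]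
        refine (hq.dvd_or_dvd ((dvd_pow_self q two_ne_zero).trans hxy)).imp (fun h ↦ ?_) fun h ↦ ?_
        · exact sq_dvd_of_dvd hq hqD ((mem_kernel hk hD).1 x.2) h
        · exact sq_dvd_of_dvd hq hqD ((mem_kernel hk hD).1 y.2) h
  refine UniqueFactorizationMonoid.of_exists_prime_factors fun a ha ↦ ?_
  obtain ⟨b, hb⟩ : ∃ b : B, b = a := ⟨a, rfl⟩
  induction b using WellFounded.induction (r := DvdNotUnit (α := B))
    wellFounded_dvdNotUnit generalizing a with
  | _ b ih =>
    by_cases hu : IsUnit b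
    · refine ⟨0, by simp, ?_⟩
      rw [Multiset.prod_zero]
      exact (associated_one_iff_isUnit.2 ((kernel_isUnit_iff hk hD).2 (hb ▸ hu))).symm
    · have hb0 : b ≠ 0 := by
        rw [hb]
        exact fun h ↦ ha (Subtype.ext h)
      obtain ⟨q, hq, hqb⟩ := WfDvdMonoid.exists_irreducible_factor hu hb0
      obtain ⟨p, hp, c, rfl⟩ := hprime q hq.prime a (hb ▸ hqb)
      have hc : c ≠ 0 := right_ne_zero_of_mul ha
      obtain ⟨f, hf, hfc⟩ := ih c ⟨fun h ↦ hc (Subtype.ext h), p,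
        fun h ↦ hp.not_isUnit ((kernel_isUnit_iff hk hD).2 h), by rw [hb, mul_comm]; rfl⟩ c hc rfl
      refine ⟨p ::ₘ f, fun r hr ↦ ?_, ?_⟩
      · rcases Multiset.mem_cons.1 hr with rfl | hr
        · exact hp
        · exact hf r hr
      · rw [Multiset.prod_cons]
        exact hfc.mul_left p

/-- The kernel of a derivation `D` with `D² = 0` in characteristic two is factorial if the
equation `D h = h²` only has solutions in the ground field. -/
theorem uniqueFactorizationMonoid_kernel_of_logarithmic [IsDomain B] [CharP B 2]
    [UniqueFactorizationMonoid B]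
    (hDD : ∀ b, D (D b) = 0) (h : ∀ b, D b = b ^ 2 → ∃ l, b = algebraMap L B l) :
    UniqueFactorizationMonoid (kernel hk hD) := by
  refine uniqueFactorizationMonoid_kernel hk hD fun q hq ⟨b, hb⟩ ↦ ?_
  -- From `D q = q b` and `D² = 0` one gets `q (b² + D b) = 0`.
  have h1 : D b = b ^ 2 := by
    have h2 := hDD q
    rw [hb, leibniz, hb, smul_eq_mul, smul_eq_mul] at h2
    refine mul_left_cancel₀ hq.ne_zero ?_
    linear_combination h2 - (q * b ^ 2) * CharTwo.two_eq_zero (R := B)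
  by_cases hb0 : b = 0
  · exact ⟨1, isUnit_one, by rw [one_mul, hb, hb0, mul_zero]⟩
  · obtain ⟨l, rfl⟩ := h b h1
    -- The logarithmic derivative `b` is itself the correcting unit: `D(b q) = b² q + b² q = 0`.
    refine ⟨algebraMap L B l, (IsUnit.mk0 l ?_).map _, ?_⟩
    · rintro rfl
      exact hb0 (map_zero _)
    · rw [leibniz, h1, hb, smul_eq_mul, smul_eq_mul]
      linear_combination (q * algebraMap L B l ^ 2) * CharTwo.two_eq_zero (R := B)

end Factorial

end Derivation

/-! ### The affine line over an algebra -/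

section PolynomialExtension

open Polynomial

variable {k R : Type*} [Field k] [CommRing R] [Algebra k R]

/-- The homomorphism `f(X) ↦ f(X + U)`. -/
noncomputable def Polynomial.translationHom (R : Type*) [CommRing R] : R[X] →+* R[X][X] :=
  eval₂RingHom ((C : R[X] →+* R[X][X]).comp (C : R →+* R[X])) (C X + X)

lemma Polynomial.translationHom_C (r : R) : translationHom R (C r) = C (C r) :=
  eval₂_C _ _

lemma Polynomial.translationHom_X : translationHom R X = C X + X :=
  eval₂_X _ _

/-- The translation action on the affine line over `R`. -/
noncomputable def ExponentialMap.translation (k R : Type*) [Field k] [CommRing R] [Algebra k R] :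
    ExponentialMap k R[X] where
  toAlgHom :=
    { translationHom R with
      commutes' := fun c ↦ translationHom_C _ }
  eval_zero a := by
    change (evalRingHom 0).comp (translationHom R) a = RingHom.id _ a
    congr 1
    ext <;> simp [translationHom_C, translationHom_X]
  comp_eq a := by
    change (mapRingHom (translationHom R)).comp (translationHom R) a =
      (eval₂RingHom ((C : R[X][X] →+* R[X][X][X]).comp (C : R[X] →+* R[X][X])) (X + C X)).comp
        (translationHom R) a
    congr 1
    ext r : 2
    · simp [translationHom_C]
    · simp [translationHom_X, add_assoc, add_comm]

lemma ExponentialMap.translation_X : (translation k R).toAlgHom X = C X + X :=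
  translationHom_X

lemma isNonRigid_polynomial [Nontrivial R] : IsNonRigid k R[X] := by
  refine ⟨.translation k R, fun h ↦ ?_⟩
  have h1 : (X : R[X]) ∈ (ExponentialMap.translation k R).invariants := h ▸ Set.mem_univ _
  rw [ExponentialMap.mem_invariants, ExponentialMap.translation_X, add_eq_left] at h1
  exact X_ne_zero h1

lemma IsAffineForm.polynomial {L : Type*} [Field L] [Algebra k L] (h : IsAffineForm 1 k L R) :
    IsAffineForm 2 k L R[X] := by
  obtain ⟨e⟩ := h
  exact ⟨(Algebra.TensorProduct.congr .refl
    ((MvPolynomial.uniqueAlgEquiv R Unit).symm.restrictScalars k)).trans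
    (MvPolynomial.rTensorAlgEquiv.trans ((MvPolynomial.mapAlgEquiv Unit e).trans
    (((MvPolynomial.sumAlgEquiv L Unit (Fin 1)).symm).trans (MvPolynomial.renameEquiv L
      (Fintype.equivFinOfCardEq (by simp))))))⟩

lemma HasRationalPoint.of_algHom {A B : Type*} [CommRing A] [CommRing B] [Algebra k A] [Algebra k B]
    (h : HasRationalPoint k B) (f : A →ₐ[k] B) : HasRationalPoint k A :=
  h.map fun ε ↦ ε.comp f

lemma HasRationalPoint.polynomial (h : HasRationalPoint k R) : HasRationalPoint k R[X] :=
  h.of_algHom ((aeval (0 : R)).restrictScalars k)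

lemma IsPolynomialRing.hasRationalPoint {n : ℕ} (h : IsPolynomialRing n k R) :
    HasRationalPoint k R :=
  h.map fun e ↦ (MvPolynomial.aeval (0 : Fin n → k)).comp e.toAlgHom

lemma IsPolynomialRing.uniqueFactorizationMonoid {n : ℕ} (h : IsPolynomialRing n k R) :
    UniqueFactorizationMonoid R := by
  obtain ⟨e⟩ := h
  exact e.symm.toMulEquiv.uniqueFactorizationMonoid inferInstance

/-- Factors of a nonzero constant polynomial over a domain are constant, so `a` stays irreducible in
`R[X]`; primality there descends to `R`. -/
lemma prime_of_irreducible_of_polynomial [IsDomain R] [UniqueFactorizationMonoid R[X]] {a : R}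
    (ha : Irreducible a) : Prime a := by
  rw [← prime_C_iff]
  refine Irreducible.prime ⟨fun h ↦ ha.not_isUnit (isUnit_C.1 h), fun f g hfg ↦ ?_⟩
  have h1 : f * g ≠ 0 := hfg ▸ C_ne_zero.2 ha.ne_zero
  have h2 := natDegree_mul (left_ne_zero_of_mul h1) (right_ne_zero_of_mul h1)
  rw [← hfg, natDegree_C] at h2
  obtain ⟨b, rfl⟩ := natDegree_eq_zero.1 (show f.natDegree = 0 by omega)
  obtain ⟨c, rfl⟩ := natDegree_eq_zero.1 (show g.natDegree = 0 by omega)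
  rw [isUnit_C, isUnit_C]
  exact ha.isUnit_or_isUnit (C_injective (by rw [hfg, C_mul]))

end PolynomialExtension

/-! ### Two equations over `𝔽₂(t)` -/

section RationalFunctions

open Polynomial

namespace RationalFunctions

variable (K : Type*) [Field K] [Algebra (ZMod 2)[X] K]

/-- The indeterminate of the field of rational functions over the field with two elements. -/
noncomputable def t : K := algebraMap (ZMod 2)[X] K X

variable [IsFractionRing (ZMod 2)[X] K]

/-- The derivation with respect to the indeterminate. -/
noncomputable def deriv : Derivation ℤ K K :=
  ((Polynomial.derivative' (R := ZMod 2)).restrictScalars ℤ).toFractionRing K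

include K in
lemma charP : CharP K 2 :=
  charP_of_injective_algebraMap (IsFractionRing.injective (ZMod 2)[X] K) 2

variable {K}

lemma deriv_algebraMap (f : (ZMod 2)[X]) :
    deriv K (algebraMap _ K f) = algebraMap _ K (derivative f) :=
  Derivation.toFractionRing_algebraMap K _ f

lemma deriv_t : deriv K (t K) = 1 := by
  rw [t, deriv_algebraMap, derivative_X, map_one]

lemma deriv_deriv (x : K) : deriv K (deriv K x) = 0 := by
  have := charP K
  have h (f : (ZMod 2)[X]) : deriv K (deriv K (algebraMap _ K f)) = 0 := by
    have : derivative (derivative f) = 0 := by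
      ext n
      rw [coeff_derivative, coeff_derivative, coeff_zero, mul_assoc]
      have : ((n + 1 : ℕ) + 1 : ZMod 2) * (n + 1) = 0 := by
        have h2 : ∀ z : ZMod 2, (z + 1 + 1) * (z + 1) = 0 := by decide
        exact_mod_cast h2 n
      rw [this, mul_zero]
    rw [deriv_algebraMap, deriv_algebraMap, this, map_zero]
  obtain ⟨f, g, hg, rfl⟩ := IsFractionRing.div_surjective (A := (ZMod 2)[X]) x
  set y := algebraMap _ K f / algebraMap _ K g with hy
  have hg0 : algebraMap _ K g ≠ 0 := by
    rw [Ne, map_eq_zero_iff _ (IsFractionRing.injective (ZMod 2)[X] K)]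
    exact nonZeroDivisors.ne_zero hg
  have h1 : algebraMap _ K g * y = algebraMap _ K f := mul_div_cancel₀ _ hg0
  have h2 := h f
  rw [← h1, Derivation.leibniz, map_add, smul_eq_mul, smul_eq_mul, Derivation.leibniz,
    Derivation.leibniz, h g] at h2
  simp only [smul_eq_mul] at h2
  refine (mul_eq_zero.1 ?_).resolve_left hg0
  linear_combination h2 - deriv K y * deriv K (algebraMap _ K g) * CharTwo.two_eq_zero (R := K)

/-- For a reduced fraction `f/G` the equation forces `G = X E` and `f(0) = 1`. Dividing by `X²` and
evaluating at zero leaves `e + 1 = e²` for `e = E(0)`, which has no solution in `𝔽₂`. -/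
lemma deriv_add_sq_ne (x : K) : deriv K x + (t K ^ 2)⁻¹ ≠ x ^ 2 := by
  have := charP K
  obtain ⟨f, g, hfg, rfl⟩ := IsFractionRing.exists_reduced_fraction (A := (ZMod 2)[X]) x
  intro h
  set y := IsLocalization.mk' K f g with hy
  have hinj := IsFractionRing.injective (ZMod 2)[X] K
  have hg0 : (g : (ZMod 2)[X]) ≠ 0 := nonZeroDivisors.ne_zero g.2
  have hgK : algebraMap _ K (g : (ZMod 2)[X]) ≠ 0 := by
    rwa [Ne, map_eq_zero_iff _ hinj]
  have htK : t K ≠ 0 := by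
    rw [t, Ne, map_eq_zero_iff _ hinj]
    exact X_ne_zero
  have h1 : algebraMap _ K (g : (ZMod 2)[X]) * y = algebraMap _ K f := by
    rw [mul_comm, hy, IsLocalization.mk'_spec]
  have h2 := congr_arg (deriv K) h1
  rw [Derivation.leibniz, deriv_algebraMap, deriv_algebraMap, smul_eq_mul, smul_eq_mul] at h2
  set G := (g : (ZMod 2)[X])
  -- clear denominators
  have h3 : X ^ 2 * (G * derivative f + f * derivative G + f ^ 2) = G ^ 2 := by
    apply hinj
    simp only [map_mul, map_add, map_pow]
    have h4 : t K ^ 2 * deriv K y + 1 = t K ^ 2 * y ^ 2 := by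
      rw [← h]
      field_simp
    rw [← h1, ← h2]
    change t K ^ 2 * _ = _
    linear_combination (algebraMap _ K G) ^ 2 * h4 +
      (t K ^ 2 * (algebraMap _ K G) ^ 2 * y ^ 2 +
      t K ^ 2 * algebraMap _ K G * y * algebraMap _ K (derivative G) - (algebraMap _ K G) ^ 2) *
      CharTwo.two_eq_zero (R := K)
  obtain ⟨E, hE⟩ : X ∣ G := prime_X.dvd_of_dvd_pow (n := 2)
    ((dvd_pow_self X two_ne_zero).trans ⟨_, h3.symm⟩)
  have hf : f.coeff 0 = 1 := by
    have h5 : f.coeff 0 ≠ 0 := fun h0 ↦ not_isUnit_X (hfg (X_dvd_iff.2 h0) ⟨E, hE⟩)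
    revert h5
    generalize f.coeff 0 = z
    revert z
    decide
  rw [hE, mul_pow] at h3
  have h6 := mul_left_cancel₀ (pow_ne_zero 2 X_ne_zero) h3
  have h7 := congr_arg (coeff · 0) h6
  simp only [derivative_mul, derivative_X, coeff_add, mul_coeff_zero, sq, coeff_X_zero, hf,
    coeff_one] at h7
  revert h7
  generalize E.coeff 0 = z
  revert z
  simp
  decide

/-- A nonzero solution would be a cube root of `t²`, hence integral and a polynomial, but 3 does not
divide 2. -/
lemma eq_zero_of_pow_four_eq {x : K} (h : x ^ 4 = t K ^ 2 * x) : x = 0 := by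
  by_contra hx
  have h1 : x ^ 3 = t K ^ 2 := mul_right_cancel₀ hx (by rw [← h]; ring)
  obtain ⟨f, rfl⟩ : ∃ f, algebraMap (ZMod 2)[X] K f = x := by
    refine IsIntegrallyClosed.isIntegral_iff.1
      (IsIntegral.of_pow (n := 3) (by norm_num) ?_)
    rw [h1, t, ← map_pow]
    exact isIntegral_algebraMap
  rw [t, ← map_pow, ← map_pow] at h1
  have h2 := congr_arg natDegree (IsFractionRing.injective (ZMod 2)[X] K h1)
  rw [natDegree_pow, natDegree_X_pow] at h2
  omega

end RationalFunctions

end RationalFunctions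

/-! ### Forms defined by derivations -/

section Examples

open MvPolynomial

variable {k L : Type*} [Field k] [Field L] [Algebra k L] {d : Derivation ℤ L L} {s : L}
  (hk : ∀ l, d l = 0 ↔ l ∈ Set.range (algebraMap k L))

/-- The form attached to the derivation that takes the values `F i` at the indeterminates. -/
noncomputable def derivationForm {n : ℕ} (F : Fin n → MvPolynomial (Fin n) L) :
    Subalgebra k (MvPolynomial (Fin n) L) :=
  Derivation.kernel (D := d.extendMvPolynomial F) hk (d.extendMvPolynomial_C F)

section General

variable {n : ℕ} {F : Fin n → MvPolynomial (Fin n) L}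

lemma extendMvPolynomial_sq [CharP L 2] (p : MvPolynomial (Fin n) L) :
    d.extendMvPolynomial F (p ^ 2) = 0 := Derivation.map_sq_eq_zero p

lemma mem_derivationForm {p : MvPolynomial (Fin n) L} :
    p ∈ derivationForm hk F ↔ d.extendMvPolynomial F p = 0 := Iff.rfl

lemma derivationForm_isUnit_iff {a : derivationForm hk F} :
    IsUnit a ↔ IsUnit (a : MvPolynomial (Fin n) L) :=
  Derivation.kernel_isUnit_iff hk _

lemma derivationForm_dvd_iff {a b : derivationForm hk F} :
    a ∣ b ↔ (a : MvPolynomial (Fin n) L) ∣ b :=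
  Derivation.kernel_dvd_iff hk _

lemma isAffineForm_derivationForm [CharP L 2] (hs : d s = 1) (hd : ∀ l, d (d l) = 0)
    (hF : ∀ i, d.extendMvPolynomial F (F i) = 0) : IsAffineForm n k L (derivationForm hk F) :=
  ⟨Derivation.kernelBaseChangeEquiv hk _ hs hd (d.comp_self_extendMvPolynomial F hd hF)⟩

/-- To decide factoriality of the form it suffices to solve `D h = h²` in degree at most one. -/
lemma isUFD_derivationForm [CharP L 2] (hd : ∀ l, d (d l) = 0)
    (hF : ∀ i, d.extendMvPolynomial F (F i) = 0) (hdeg : ∀ i, (F i).totalDegree ≤ 2)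
    (h : ∀ (b : L) (c : Fin n → L), d.extendMvPolynomial F (C b + ∑ i, C (c i) * X i) =
      (C b + ∑ i, C (c i) * X i) ^ 2 → c = 0) : IsUFD (derivationForm hk F) := by
  refine ⟨inferInstance, Derivation.uniqueFactorizationMonoid_kernel_of_logarithmic hk _
    (d.comp_self_extendMvPolynomial F hd hF) fun p hp' ↦ ?_⟩
  have hp : d.extendMvPolynomial F p = p ^ 2 := hp'
  have h1 := d.totalDegree_extendMvPolynomial_le F hdeg p
  -- Squaring doubles the degree, while `D` raises it by at most one.
  have h2 : p.totalDegree ≤ 1 := by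
    by_cases hp0 : p = 0
    · simp [hp0]
    · rw [hp, sq, totalDegree_mul_of_isDomain hp0 hp0] at h1
      omega
  have h3 := eq_of_totalDegree_le_one h2
  rw [h3] at hp
  have h4 := h _ _ hp
  refine ⟨p.coeff 0, ?_⟩
  rw [h3]
  have h5 (i : Fin n) : p.coeff (Finsupp.single i 1) = 0 := congr_fun h4 i
  simp [h5, algebraMap_eq]

/-- The origin is a rational point if it is a zero of the vector field. -/
lemma hasRationalPoint_derivationForm (hF : ∀ i, aeval (0 : Fin n → L) (F i) = 0) :
    HasRationalPoint k (derivationForm hk F) := by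
  -- Evaluation at the origin intertwines `D` with `d`, so it maps the kernel into the constants.
  have h1 (p : MvPolynomial (Fin n) L) :
      aeval (0 : Fin n → L) (d.extendMvPolynomial F p) = d (aeval (0 : Fin n → L) p) := by
    induction p using MvPolynomial.induction_on with
    | C r => simp
    | add p q hp hq => rw [map_add, map_add, hp, hq, map_add, map_add]
    | mul_X p i hp =>
      rw [Derivation.leibniz, Derivation.extendMvPolynomial_X, map_add, smul_eq_mul, smul_eq_mul,
        map_mul, map_mul, hF, map_mul, aeval_X, Pi.zero_apply]
      simp
  let g : derivationForm hk F →ₐ[k] L :=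
    ((aeval (0 : Fin n → L)).restrictScalars k).comp (derivationForm hk F).val
  refine ⟨(Algebra.botEquiv k L).toAlgHom.comp (g.codRestrict ⊥ fun p ↦ ?_)⟩
  rw [Algebra.mem_bot, ← hk]
  change d (aeval (0 : Fin n → L) p.1) = 0
  rw [← h1, (mem_derivationForm hk).1 p.2, map_zero]

end General

section Conic

/-- The derivation `w ↦ w² + β`. -/
noncomputable def conicField (β : L) : Fin 1 → MvPolynomial (Fin 1) L := fun _ ↦ X 0 ^ 2 + C β

variable {β : L}

lemma totalDegree_conicField_le (i : Fin 1) : (conicField β i).totalDegree ≤ 2 :=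
  (totalDegree_add _ _).trans (by simp)

lemma extendMvPolynomial_conicField [CharP L 2] (hβ : d β = 0) (i : Fin 1) :
    d.extendMvPolynomial (conicField β) (conicField β i) = 0 := by
  conv_lhs => rw [conicField]
  rw [map_add, extendMvPolynomial_sq, Derivation.extendMvPolynomial_C, hβ, map_zero, add_zero]

lemma extendMvPolynomial_conicField_eq_sq (a b : L)
    [CharP L 2] (h : d.extendMvPolynomial (conicField β) (C a + C b * X 0) =
      (C a + C b * X 0) ^ 2) : b = b ^ 2 ∧ d a + b * β = a ^ 2 := by
  rw [map_add, Derivation.leibniz, Derivation.extendMvPolynomial_C, Derivation.extendMvPolynomial_C,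
    Derivation.extendMvPolynomial_X, conicField, smul_eq_mul, smul_eq_mul] at h
  have h1 := congr_arg (aeval fun _ ↦ (Polynomial.X : L[X])) h
  simp only [map_add, map_mul, map_pow, aeval_X, algHom_C, Polynomial.algebraMap_apply,
    Algebra.algebraMap_self_apply] at h1
  have h2 : Polynomial.C (d a + b * β - a ^ 2) + Polynomial.C (d b - 2 * a * b) * Polynomial.X +
      Polynomial.C (b - b ^ 2) * Polynomial.X ^ 2 = 0 := by
    simp only [map_add, map_sub, map_mul, map_pow, map_ofNat]
    linear_combination h1
  have h3 := congr_arg (Polynomial.coeff · 2) h2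
  have h4 := congr_arg (Polynomial.coeff · 0) h2
  simp only [Polynomial.coeff_add, Polynomial.coeff_C_mul, Polynomial.coeff_X_pow,
    Polynomial.coeff_X, Polynomial.coeff_C, Polynomial.coeff_zero] at h3 h4
  norm_num at h3 h4
  exact ⟨sub_eq_zero.1 h3, sub_eq_zero.1 h4⟩

/-- For `h = a + b w` the `w²` coefficient gives `b = b²`; if `b = 1`, the constant term is the
excluded equation for `a`. -/
lemma isUFD_conic [CharP L 2] (hd : ∀ l, d (d l) = 0) (hβ : d β = 0)
    (hne : ∀ x, d x + β ≠ x ^ 2) : IsUFD (derivationForm hk (conicField β)) := by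
  refine isUFD_derivationForm hk hd (extendMvPolynomial_conicField hβ) totalDegree_conicField_le
    fun a c h ↦ ?_
  rw [Fin.sum_univ_one] at h
  obtain ⟨h1, h2⟩ := extendMvPolynomial_conicField_eq_sq a (c 0) h
  ext i
  rw [Subsingleton.elim i 0, Pi.zero_apply]
  by_contra h0
  have h3 : c 0 = 1 := by
    refine mul_left_cancel₀ h0 ?_
    rw [← sq, ← h1, mul_one]
  rw [h3, one_mul] at h2
  exact hne a h2

/-- The invariants `x = D w` and `z = w + s x` satisfy `z² = x + β + s² x²`. At a rational point,
the value of `w = z + s x` would solve the excluded equation. -/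
lemma not_hasRationalPoint_conic [CharP L 2] (hs : d s = 1) (hβ : d β = 0)
    (hne : ∀ x, d x + β ≠ x ^ 2) : ¬ HasRationalPoint k (derivationForm hk (conicField β)) := by
  rintro ⟨ρ⟩
  obtain ⟨τ, hτ⟩ := (hk (s ^ 2)).1 (Derivation.map_sq_eq_zero s)
  obtain ⟨β', hβ'⟩ := (hk β).1 hβ
  let x : derivationForm hk (conicField β) := ⟨conicField β 0, extendMvPolynomial_conicField hβ 0⟩
  let z : derivationForm hk (conicField β) := ⟨X 0 + C s * conicField β 0, by
    rw [mem_derivationForm, map_add, Derivation.leibniz, extendMvPolynomial_conicField hβ,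
      Derivation.extendMvPolynomial_C, hs, Derivation.extendMvPolynomial_X, map_one, smul_zero,
      zero_add, smul_eq_mul, mul_one, CharTwo.add_self_eq_zero]⟩
  have hmap (c : k) : algebraMap k (MvPolynomial (Fin 1) L) c = C (algebraMap k L c) := rfl
  have hz : z ^ 2 = x + algebraMap k _ β' + algebraMap k _ τ * x ^ 2 := by
    refine Subtype.ext ?_
    push_cast
    rw [hmap, hmap, hβ', hτ, CharTwo.add_sq]
    change X 0 ^ 2 + (C s * conicField β 0) ^ 2 =
      conicField β 0 + C β + C (s ^ 2) * conicField β 0 ^ 2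
    simp only [conicField, map_pow]
    linear_combination - C β * CharTwo.two_eq_zero (R := MvPolynomial (Fin 1) L)
  have h1 := congr_arg (algebraMap k L) (congr_arg ρ hz)
  simp only [map_add, map_mul, map_pow, AlgHom.commutes, Algebra.algebraMap_self_apply, hβ', hτ]
    at h1
  refine hne (algebraMap k L (ρ z) + s * algebraMap k L (ρ x)) ?_
  rw [map_add, Derivation.leibniz, (hk _).2 ⟨_, rfl⟩, (hk _).2 ⟨_, rfl⟩, hs, CharTwo.add_sq,
    mul_pow, h1]
  simp only [zero_add, smul_eq_mul, mul_one]
  linear_combination -(s ^ 2 * (algebraMap k L (ρ x)) ^ 2) * CharTwo.two_eq_zero (R := L)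

/-- The kernel contains no polynomial of degree one in `w`, so `w²` is irreducible there. It divides
the square of `w + s w²` but not `w + s w²` itself. -/
lemma exists_irreducible_not_prime [CharP L 2] (hs : d s = 1) :
    ∃ p : derivationForm hk (conicField (0 : L)), Irreducible p ∧ ¬ Prime p := by
  have hF (i : Fin 1) : conicField (0 : L) i = X 0 ^ 2 := by rw [conicField, map_zero, add_zero]
  let x : derivationForm hk (conicField (0 : L)) := ⟨X 0 ^ 2, extendMvPolynomial_sq _⟩
  let z : derivationForm hk (conicField (0 : L)) := ⟨X 0 + C s * X 0 ^ 2, by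
    rw [mem_derivationForm, map_add, Derivation.leibniz, extendMvPolynomial_sq,
      Derivation.extendMvPolynomial_C, hs, Derivation.extendMvPolynomial_X, hF, map_one, smul_zero,
      zero_add, smul_eq_mul, mul_one, CharTwo.add_self_eq_zero]⟩
  have hnu : ¬ IsUnit (X 0 : MvPolynomial (Fin 1) L) := X_prime.not_isUnit
  refine ⟨x, ⟨fun hu ↦ ?_, fun f g hfg ↦ ?_⟩, fun hx ↦ ?_⟩
  · exact hnu ((isUnit_pow_iff two_ne_zero).1 ((derivationForm_isUnit_iff hk).1 hu))
  · have hfg' : (X 0 ^ 2 : MvPolynomial (Fin 1) L) = f.1 * g.1 := congr_arg Subtype.val hfg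
    have hne : f.1 * g.1 ≠ 0 := hfg' ▸ pow_ne_zero 2 (X_ne_zero 0)
    have hdeg := totalDegree_mul_of_isDomain (left_ne_zero_of_mul hne) (right_ne_zero_of_mul hne)
    rw [← hfg', totalDegree_X_pow] at hdeg
    have hunit (f : derivationForm hk (conicField (0 : L))) (hf0 : f.1 ≠ 0)
        (hf : f.1.totalDegree ≤ 1) : IsUnit f := by
      rw [derivationForm_isUnit_iff hk]
      have h1 := eq_of_totalDegree_le_one hf
      rw [Fin.sum_univ_one] at h1
      have h2 := (mem_derivationForm hk).1 f.2
      generalize f.1.coeff 0 = a at h1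
      generalize f.1.coeff (Finsupp.single 0 1) = b at h1
      rw [h1, map_add, Derivation.leibniz, Derivation.extendMvPolynomial_C,
        Derivation.extendMvPolynomial_C, Derivation.extendMvPolynomial_X, hF, smul_eq_mul,
        smul_eq_mul] at h2
      have h3 := congr_arg (Polynomial.coeff · 2)
        (congr_arg (aeval fun _ ↦ (Polynomial.X : L[X])) h2)
      simp only [map_add, map_mul, map_pow, map_zero, aeval_X, algHom_C,
        Polynomial.algebraMap_apply, Algebra.algebraMap_self_apply, Polynomial.coeff_add,
        Polynomial.coeff_C_mul, Polynomial.coeff_X_mul, Polynomial.coeff_X_pow,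
        Polynomial.coeff_C, Polynomial.coeff_zero] at h3
      norm_num [Polynomial.coeff_C] at h3
      rw [h3, map_zero, zero_mul, add_zero] at h1
      rw [h1] at hf0 ⊢
      exact (IsUnit.mk0 a fun h ↦ hf0 (by rw [h, map_zero])).map C
    by_cases hf : f.1.totalDegree ≤ 1
    · exact .inl (hunit f (left_ne_zero_of_mul hne) hf)
    · exact .inr (hunit g (right_ne_zero_of_mul hne) (by omega))
  · have h1 : x ∣ z ^ 2 := by
      rw [derivationForm_dvd_iff hk]
      change X 0 ^ 2 ∣ (X 0 + C s * X 0 ^ 2) ^ 2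
      exact ⟨(1 + C s * X 0) ^ 2, by ring⟩
    have h2 := hx.dvd_of_dvd_pow h1
    rw [derivationForm_dvd_iff hk] at h2
    obtain ⟨q, hq⟩ : (X 0 ^ 2 : MvPolynomial (Fin 1) L) ∣ X 0 + C s * X 0 ^ 2 := h2
    have h3 : (X 0 : MvPolynomial (Fin 1) L) * (q - C s) = 1 :=
      mul_left_cancel₀ (X_ne_zero 0) (by linear_combination -hq)
    exact hnu (IsUnit.of_mul_eq_one _ h3)

end Conic

section Plane

/-- The derivation `w ↦ y²`, `y ↦ s² w²`. -/
noncomputable def planeField (s : L) : Fin 2 → MvPolynomial (Fin 2) L :=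
  ![X 1 ^ 2, C (s ^ 2) * X 0 ^ 2]

lemma totalDegree_planeField_le (i : Fin 2) : (planeField s i).totalDegree ≤ 2 := by
  fin_cases i
  · simp [planeField]
  · exact (totalDegree_mul _ _).trans (by rw [totalDegree_C, totalDegree_X_pow])

lemma extendMvPolynomial_planeField [CharP L 2] (i : Fin 2) :
    d.extendMvPolynomial (planeField s) (planeField s i) = 0 := by
  fin_cases i
  · exact extendMvPolynomial_sq _
  · change d.extendMvPolynomial (planeField s) (C (s ^ 2) * X 0 ^ 2) = 0
    rw [map_pow, ← mul_pow, extendMvPolynomial_sq]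

lemma isUFD_plane [CharP L 2] (hd : ∀ l, d (d l) = 0)
    (hne : ∀ x : L, x ^ 4 = s ^ 2 * x → x = 0) : IsUFD (derivationForm hk (planeField s)) := by
  refine isUFD_derivationForm hk hd extendMvPolynomial_planeField totalDegree_planeField_le
    fun a c h ↦ ?_
  rw [Fin.sum_univ_two, map_add, map_add, Derivation.leibniz, Derivation.leibniz,
    Derivation.extendMvPolynomial_C, Derivation.extendMvPolynomial_C,
    Derivation.extendMvPolynomial_C, Derivation.extendMvPolynomial_X,
    Derivation.extendMvPolynomial_X, smul_eq_mul, smul_eq_mul, smul_eq_mul, smul_eq_mul] at h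
  have e0 : planeField s 0 = X 1 ^ 2 := rfl
  have e1 : planeField s 1 = C (s ^ 2) * X 0 ^ 2 := rfl
  rw [e0, e1] at h
  -- Restricting to the two axes isolates the pure square terms: `s² c₁ = c₀²` and `c₀ = c₁²`,
  -- whence `c₁⁴ = s² c₁`.
  have h0 := congr_arg (aeval ![(Polynomial.X : L[X]), 0]) h
  have h1 := congr_arg (aeval ![0, (Polynomial.X : L[X])]) h
  simp only [map_add, map_mul, aeval_X, algHom_C, Polynomial.algebraMap_apply,
    Algebra.algebraMap_self_apply, map_pow, Matrix.cons_val_zero, Matrix.cons_val_one] at h0 h1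
  have h2 : Polynomial.C (d a - a ^ 2) + Polynomial.C (d (c 0) - 2 * a * c 0) * Polynomial.X +
      Polynomial.C (c 1 * s ^ 2 - c 0 ^ 2) * Polynomial.X ^ 2 = 0 := by
    simp only [map_sub, map_mul, map_pow, map_ofNat]
    linear_combination h0
  have h3 : Polynomial.C (d a - a ^ 2) + Polynomial.C (d (c 1) - 2 * a * c 1) * Polynomial.X +
      Polynomial.C (c 0 - c 1 ^ 2) * Polynomial.X ^ 2 = 0 := by
    simp only [map_sub, map_mul, map_pow, map_ofNat]
    linear_combination h1
  have h4 := congr_arg (Polynomial.coeff · 2) h2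
  have h5 := congr_arg (Polynomial.coeff · 2) h3
  simp only [Polynomial.coeff_add, Polynomial.coeff_C_mul, Polynomial.coeff_X_pow,
    Polynomial.coeff_X, Polynomial.coeff_C, Polynomial.coeff_zero] at h4 h5
  norm_num at h4 h5
  have h6 : c 1 = 0 := hne _ (by linear_combination -h4 - (c 0 + c 1 ^ 2) * h5)
  have h7 : c 0 = 0 := by rw [sub_eq_zero.1 h5, h6, zero_pow two_ne_zero]
  ext i
  fin_cases i
  · exact h7
  · exact h6

/-- The left-hand side is `(f + s g)²` over `L`. As `1` and `s` are independent over `k`, no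
monomial of `g` cancels in `f + s g`. -/
lemma two_mul_totalDegree_le {σ : Type*} [CharP L 2] (hs : d s = 1) {τ : k}
    (hk : ∀ l, d l = 0 ↔ l ∈ Set.range (algebraMap k L))
    (hτ : algebraMap k L τ = s ^ 2) {f g h : MvPolynomial σ k} (hfg : f ^ 2 + C τ * g ^ 2 = h) :
    2 * g.totalDegree ≤ h.totalDegree := by
  set p : MvPolynomial σ L := map (algebraMap k L) f + C s * map (algebraMap k L) g with hp
  have h1 : p ^ 2 = map (algebraMap k L) h := by
    rw [hp, CharTwo.add_sq, ← hfg, map_add, map_mul, map_pow, map_pow, map_C, hτ, mul_pow, map_pow]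
  have h2 : g.totalDegree ≤ p.totalDegree := by
    refine Finset.sup_mono fun m hm ↦ ?_
    rw [mem_support_iff] at hm ⊢
    intro h0
    rw [hp, coeff_add, coeff_C_mul, coeff_map, coeff_map] at h0
    have h3 := congr_arg d h0
    rw [map_add, Derivation.leibniz, (hk _).2 ⟨_, rfl⟩, (hk _).2 ⟨_, rfl⟩, hs, map_zero] at h3
    simp only [smul_eq_mul, mul_zero, zero_add, mul_one] at h3
    exact hm ((map_eq_zero_iff _ (algebraMap k L).injective).1 h3)
  have h3 : (map (algebraMap k L) h).totalDegree ≤ h.totalDegree :=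
    Finset.sup_mono (support_map_subset _ _)
  rw [← h1] at h3
  by_cases hp0 : p = 0
  · rw [hp0, totalDegree_zero] at h2
    omega
  · rw [sq, totalDegree_mul_of_isDomain hp0 hp0] at h3
    omega

/-- With `x = X₀²`, `y = X₁²` the kernel satisfies `z² + τ y² = x` and `u² + τ (τ x)² = y`. In a
polynomial ring over `k` this would give `2 deg y ≤ deg x` and `2 deg x ≤ deg y`, making `x` a
constant. -/
lemma not_isPolynomialRing_plane [CharP L 2] (hs : d s = 1) :
    ¬ IsPolynomialRing 2 k (derivationForm hk (planeField s)) := by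
  rintro ⟨e⟩
  obtain ⟨τ, hτ⟩ := (hk (s ^ 2)).1 (Derivation.map_sq_eq_zero s)
  let x : derivationForm hk (planeField s) := ⟨X 0 ^ 2, extendMvPolynomial_sq _⟩
  let y : derivationForm hk (planeField s) := ⟨X 1 ^ 2, extendMvPolynomial_sq _⟩
  let z : derivationForm hk (planeField s) := ⟨X 0 + C s * X 1 ^ 2, by
    rw [mem_derivationForm, map_add, Derivation.leibniz, extendMvPolynomial_sq,
      Derivation.extendMvPolynomial_C, hs, Derivation.extendMvPolynomial_X, map_one, smul_zero,
      zero_add, smul_eq_mul, mul_one]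
    exact CharTwo.add_self_eq_zero _⟩
  let u : derivationForm hk (planeField s) := ⟨X 1 + C s * (C (s ^ 2) * X 0 ^ 2), by
    have : d.extendMvPolynomial (planeField s) (C (s ^ 2) * X 0 ^ 2) = 0 :=
      extendMvPolynomial_planeField 1
    rw [mem_derivationForm, map_add, Derivation.leibniz, this,
      Derivation.extendMvPolynomial_C, hs, Derivation.extendMvPolynomial_X, map_one, smul_zero,
      zero_add, smul_eq_mul, mul_one]
    exact CharTwo.add_self_eq_zero _⟩
  have hmap (c : k) : algebraMap k (MvPolynomial (Fin 2) L) c = C (algebraMap k L c) := rfl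
  have h2 := CharTwo.two_eq_zero (R := MvPolynomial (Fin 2) L)
  have hz : z ^ 2 + algebraMap k _ τ * y ^ 2 = x := by
    refine Subtype.ext ?_
    push_cast
    rw [hmap, hτ]
    change (X 0 + C s * X 1 ^ 2) ^ 2 + C (s ^ 2) * (X 1 ^ 2) ^ 2 = X 0 ^ 2
    rw [map_pow]
    linear_combination (X 0 * C s * X 1 ^ 2 + C s ^ 2 * X 1 ^ 4) * h2
  have hu : u ^ 2 + algebraMap k _ τ * (algebraMap k _ τ * x) ^ 2 = y := by
    refine Subtype.ext ?_
    push_cast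
    rw [hmap, hτ]
    change (X 1 + C s * (C (s ^ 2) * X 0 ^ 2)) ^ 2 + C (s ^ 2) * (C (s ^ 2) * X 0 ^ 2) ^ 2 = X 1 ^ 2
    rw [map_pow]
    linear_combination (X 1 * C s ^ 3 * X 0 ^ 2 + C s ^ 6 * X 0 ^ 4) * h2
  have hz' := congr_arg e hz
  have hu' := congr_arg e hu
  simp only [map_add, map_mul, map_pow, AlgEquiv.commutes, algebraMap_eq] at hz' hu'
  have d1 := two_mul_totalDegree_le hs hk hτ hz'
  have d2 := two_mul_totalDegree_le hs hk hτ hu'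
  have hτ0 : τ ≠ 0 := by
    rintro rfl
    rw [map_zero, eq_comm, pow_eq_zero_iff two_ne_zero] at hτ
    rw [hτ, map_zero] at hs
    exact zero_ne_one hs
  have hx0 : e x ≠ 0 := by
    rw [Ne, map_eq_zero_iff _ e.injective]
    exact fun h ↦ pow_ne_zero 2 (X_ne_zero 0) (congr_arg Subtype.val h)
  rw [totalDegree_mul_of_isDomain (C_ne_zero.2 hτ0) hx0, totalDegree_C, zero_add] at d2
  have h3 := totalDegree_eq_zero_iff_eq_C.1 (show (e x).totalDegree = 0 by omega)
  rw [← algebraMap_eq, ← e.commutes] at h3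
  have h4 : (X 0 ^ 2 : MvPolynomial (Fin 2) L) = C _ := congr_arg Subtype.val (e.injective h3)
  have h5 := congr_arg totalDegree h4
  rw [totalDegree_X_pow, totalDegree_C] at h5
  omega

end Plane

end Examples

/-! ### The three counterexamples and the final statement -/

section Counterexamples

open RationalFunctions

variable (K : Type*) [Field K] [Algebra (ZMod 2)[X] K] [IsFractionRing (ZMod 2)[X] K]

lemma deriv_eq_zero_iff_mem_range (l : K) :
    deriv K l = 0 ↔ l ∈ Set.range (algebraMap (deriv K).constants K) :=
  ⟨fun h ↦ ⟨⟨l, h⟩, rfl⟩, by rintro ⟨l, rfl⟩; exact l.2⟩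

lemma deriv_t_sq_inv : deriv K (t K ^ 2)⁻¹ = 0 := by
  have := charP K
  rw [← inv_pow, Derivation.map_sq_eq_zero]

/-- The affine line over a form of the affine line that has a rational point but is not
factorial. -/
theorem exists_nonRigid_isAffineForm_hasRationalPoint :
    ∃ (k L A : Type) (_ : Field k) (_ : Field L) (_ : Algebra k L) (_ : CommRing A)
      (_ : Algebra k A), IsAffineForm 2 k L A ∧ HasRationalPoint k A ∧ IsNonRigid k A ∧
        ¬ IsPolynomialRing 2 k A := by
  let K := FractionRing (ZMod 2)[X]
  have := charP K
  have hk := deriv_eq_zero_iff_mem_range K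
  let R := derivationForm hk (conicField (0 : K))
  refine ⟨(deriv K).constants, K, R[X], inferInstance, inferInstance, inferInstance, inferInstance,
    inferInstance, ?_, ?_, isNonRigid_polynomial, fun h ↦ ?_⟩
  · exact (isAffineForm_derivationForm hk deriv_t deriv_deriv
      (extendMvPolynomial_conicField (map_zero _))).polynomial
  · exact (hasRationalPoint_derivationForm hk fun i ↦ by simp [conicField]).polynomial
  · have := h.uniqueFactorizationMonoid
    obtain ⟨p, hp, hp'⟩ := exists_irreducible_not_prime hk deriv_t
    exact hp' (prime_of_irreducible_of_polynomial hp)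

/-- The affine line over a factorial form of the affine line without rational points. -/
theorem exists_nonRigid_isAffineForm_isUFD :
    ∃ (k L A : Type) (_ : Field k) (_ : Field L) (_ : Algebra k L) (_ : CommRing A)
      (_ : Algebra k A), IsAffineForm 2 k L A ∧ IsUFD A ∧ IsNonRigid k A ∧
        ¬ IsPolynomialRing 2 k A := by
  let K := FractionRing (ZMod 2)[X]
  have := charP K
  have hk := deriv_eq_zero_iff_mem_range K
  have hβ := deriv_t_sq_inv K
  let R := derivationForm hk (conicField (t K ^ 2)⁻¹)
  refine ⟨(deriv K).constants, K, R[X], inferInstance, inferInstance, inferInstance, inferInstance,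
    inferInstance, ?_, ?_, isNonRigid_polynomial, fun h ↦ ?_⟩
  · exact (isAffineForm_derivationForm hk deriv_t deriv_deriv
      (extendMvPolynomial_conicField hβ)).polynomial
  · have : UniqueFactorizationMonoid R := (isUFD_conic hk deriv_deriv hβ deriv_add_sq_ne).2
    exact ⟨inferInstance, inferInstance⟩
  · exact not_hasRationalPoint_conic hk deriv_t hβ deriv_add_sq_ne
      (h.hasRationalPoint.of_algHom Polynomial.CAlgHom)

/-- A factorial form of the affine plane with a rational point. -/
theorem exists_isUFD_isAffineForm_hasRationalPoint :
    ∃ (k L A : Type) (_ : Field k) (_ : Field L) (_ : Algebra k L) (_ : CommRing A)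
      (_ : Algebra k A), IsAffineForm 2 k L A ∧ IsUFD A ∧ HasRationalPoint k A ∧
        ¬ IsPolynomialRing 2 k A := by
  let K := FractionRing (ZMod 2)[X]
  have := charP K
  have hk := deriv_eq_zero_iff_mem_range K
  refine ⟨(deriv K).constants, K, derivationForm hk (planeField (t K)), inferInstance,
    inferInstance, inferInstance, inferInstance, inferInstance, ?_, ?_, ?_, ?_⟩
  · exact isAffineForm_derivationForm hk deriv_t deriv_deriv extendMvPolynomial_planeField
  · exact isUFD_plane hk deriv_deriv fun _ ↦ eq_zero_of_pow_four_eq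
  · exact hasRationalPoint_derivationForm hk fun i ↦ by fin_cases i <;> simp [planeField]
  · exact not_isPolynomialRing_plane hk deriv_t

end Counterexamples

theorem theoremB :
    -- the theorem
    (∀ (k L A : Type*) [Field k] [Field L] [Algebra k L] [CommRing A] [Algebra k A],
      IsAffineForm 2 k L A → IsUFD A → HasRationalPoint k A → IsNonRigid k A →
        IsPolynomialRing 2 k A) ∧
    -- factoriality cannot be dropped
    (∃ (k L A : Type) (_ : Field k) (_ : Field L) (_ : Algebra k L) (_ : CommRing A)
      (_ : Algebra k A),
      IsAffineForm 2 k L A ∧ HasRationalPoint k A ∧ IsNonRigid k A ∧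
        ¬ IsPolynomialRing 2 k A) ∧
    -- the existence of a rational point cannot be dropped
    (∃ (k L A : Type) (_ : Field k) (_ : Field L) (_ : Algebra k L) (_ : CommRing A)
      (_ : Algebra k A),
      IsAffineForm 2 k L A ∧ IsUFD A ∧ IsNonRigid k A ∧
        ¬ IsPolynomialRing 2 k A) ∧
    -- non-rigidity cannot be dropped
    (∃ (k L A : Type) (_ : Field k) (_ : Field L) (_ : Algebra k L) (_ : CommRing A)
      (_ : Algebra k A),
      IsAffineForm 2 k L A ∧ IsUFD A ∧ HasRationalPoint k A ∧
        ¬ IsPolynomialRing 2 k A) :=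
  ⟨fun _ _ _ _ _ _ _ _ h hA hpt hφ ↦ isPolynomialRing_of_isAffineForm h hA hpt hφ,
    exists_nonRigid_isAffineForm_hasRationalPoint, exists_nonRigid_isAffineForm_isUFD,
    exists_isUFD_isAffineForm_hasRationalPoint⟩
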